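/- **Gauge-invariance uniqueness theorem.** Let $\mathscr A$ be a set (the alphabet, of any cardinality), and let $\mathsf X\subseteq\mathscr A^{\mathbb N}$ be a subshift, i.e. the set of all sequences none of whose finite words belongs to some given set $F$ of finite words. Assume that, if $\mathsf X\neq\emptyset$, every letter of $\mathscr A$ occurs in some element of $\mathsf X$. Let $\mathcal L_{\mathsf X}$ be the language of $\mathsf X$ (the finite words, including the empty word $\omega$, that occur in elements of $\mathsf X$). For $\alpha,\beta\in\mathcal L_{\mathsf X}$ put $C(\alpha,\beta)=\{\beta x\in\mathsf X:\alpha x\in\mathsf X\}$, and let $\mathcal U$ be the Boolean algebra of subsets of $\mathsf X$ generated by all the sets $C(\alpha,\beta)$. Let $\widetilde{\mathcal O}_{\mathsf X}$ be the unital subshift C*-algebra of $\mathsf X$, that is, the universal unital C*-algebra generated by projections $\{p_A:A\in\mathcal U\}$ and partial isometries $\{s_a:a\in\mathscr A\}$ subject to the relations 1. $p_{\mathsf X}=1$, $p_{A\cap B}=p_Ap_B$, $p_{A\cup B}=p_A+p_B-p_{A\cap B}$ and $p_\emptyset=0$ for all $A,B\in\mathcal U$; 2. $s_\beta s_\alpha^*s_\alpha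 s_\beta^*=p_{C(\alpha,\beta)}$ for all $\alpha,\beta\in\mathcal L_{\mathsf X}$, where $s_\omega=1$ and $s_\alpha=s_{\alpha_1}\cdots s_{\alpha_n}$ for $\alpha=\alpha_1\cdots\alpha_n$. Let $\gamma$ be the gauge action of the circle group $\mathbb T$ on $\widetilde{\mathcal O}_{\mathsf X}$, given by the $*$-automorphisms $\gamma_z$ with $\gamma_z(p_A)=p_A$ and $\gamma_z(s_a)=zs_a$ for $z\in\mathbb T$, $A\in\mathcal U$, $a\in\mathscr A$. Let $B$ be a (not necessarily unital) C*-algebra and $\Phi:\widetilde{\mathcal O}_{\mathsf X}\to B$ a (not necessarily unital) $*$-homomorphism. Suppose that $\Phi(p_A)\neq0$ for all $A\in\mathcal U\setminus\{\emptyset\}$, and that there is an action $\beta$ of $\mathbb T$ on $B$ by $*$-automorphisms that is strongly continuous (i.e. $z\mapsto\beta_z(b)$ is norm continuous for every $b\in B$) and satisfies $\Phi\circ\gamma_z=\beta_z\circ\Phi$ for all $z\in\mathbb T$. Then $\Phi$ is injective. -/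

import Mathlib

noncomputable section

universe u v

/-! ## The free unital complex *-algebra on a set of generators -/

/-- The free unital complex `*`-algebra on `G`: noncommutative polynomials with complex
coefficients in the letters `x_g` (left summand) and formal adjoints `x_g^*` (right summand). -/
def FreeStar (G : Type u) : Type u := FreeAlgebra ℂ (G ⊕ G)

namespace FreeStar

variable {G : Type u}

instance : Ring (FreeStar G) := inferInstanceAs (Ring (FreeAlgebra ℂ (G ⊕ G)))

instance : Algebra ℂ (FreeStar G) := inferInstanceAs (Algebra ℂ (FreeAlgebra ℂ (G ⊕ G)))

/-- The letters. -/
def letter (x : G ⊕ G) : FreeStar G := FreeAlgebra.ι ℂ x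

/-- The generators. -/
def of (g : G) : FreeStar G := letter (Sum.inl g)

theorem induct {motive : FreeStar G → Prop}
    (scalar : ∀ c : ℂ, motive (algebraMap ℂ (FreeStar G) c))
    (letter : ∀ x, motive (letter x))
    (mul : ∀ a b, motive a → motive b → motive (a * b))
    (add : ∀ a b, motive a → motive b → motive (a + b)) (a : FreeStar G) : motive a :=
  FreeAlgebra.induction (R := ℂ) (X := G ⊕ G) (motive := motive) scalar letter mul add a

/-- The opposite algebra with the conjugate scalar multiplication. -/
abbrev conjAlgebra : Algebra ℂ (FreeStar G)ᵐᵒᵖ :=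
  RingHom.toAlgebra' ((algebraMap ℂ (FreeStar G)ᵐᵒᵖ).comp (starRingEnd ℂ))
    (fun c x => Algebra.commutes (starRingEnd ℂ c) x)

/-- The conjugate-linear anti-multiplicative map exchanging `x_g` and `x_g^*`. -/
def adj : FreeStar G →+* (FreeStar G)ᵐᵒᵖ :=
  letI := conjAlgebra (G := G)
  (FreeAlgebra.lift ℂ (fun x : G ⊕ G => MulOpposite.op (letter x.swap)) :
    FreeAlgebra ℂ (G ⊕ G) →ₐ[ℂ] (FreeStar G)ᵐᵒᵖ).toRingHom

theorem adj_letter (x : G ⊕ G) : adj (letter x) = MulOpposite.op (letter x.swap) :=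
  letI := conjAlgebra (G := G)
  FreeAlgebra.lift_ι_apply (R := ℂ)
    (fun x : G ⊕ G => (MulOpposite.op (letter x.swap) : (FreeStar G)ᵐᵒᵖ)) x

theorem adj_scalar (c : ℂ) : adj (algebraMap ℂ (FreeStar G) c) =
    MulOpposite.op (algebraMap ℂ (FreeStar G) (starRingEnd ℂ c)) :=
  letI := conjAlgebra (G := G)
  (FreeAlgebra.lift ℂ (fun x : G ⊕ G => MulOpposite.op (letter x.swap)) :
    FreeAlgebra ℂ (G ⊕ G) →ₐ[ℂ] (FreeStar G)ᵐᵒᵖ).commutes c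

theorem adj_adj (x : FreeStar G) : (adj (adj x).unop).unop = x := by
  induction x using induct with
  | scalar c => simp [adj_scalar]
  | letter x => simp [adj_letter]
  | mul a b ha hb => simp [ha, hb]
  | add a b ha hb => simp [ha, hb]

instance : StarRing (FreeStar G) where
  star x := (adj x).unop
  star_involutive := adj_adj
  star_mul a b := by simp
  star_add a b := by simp

theorem star_letter (x : G ⊕ G) : star (letter x) = letter x.swap :=
  congrArg MulOpposite.unop (adj_letter x)

theorem star_scalar (c : ℂ) :
    star (algebraMap ℂ (FreeStar G) c) = algebraMap ℂ (FreeStar G) (star c) :=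
  congrArg MulOpposite.unop (adj_scalar c)

instance : StarModule ℂ (FreeStar G) where
  star_smul c x := by
    rw [Algebra.smul_def, star_mul, star_scalar, Algebra.smul_def, Algebra.commutes]

/-- Evaluation of `*`-polynomials at a family of elements, as a homomorphism of algebras. -/
def evalAlg {E : Type v} [Ring E] [Algebra ℂ E] [StarRing E] (f : G → E) :
    FreeStar G →ₐ[ℂ] E :=
  FreeAlgebra.lift ℂ (Sum.elim f (fun g => star (f g)))

theorem evalAlg_letter {E : Type v} [Ring E] [Algebra ℂ E] [StarRing E] (f : G → E)
    (x : G ⊕ G) : evalAlg f (letter x) = Sum.elim f (fun g => star (f g)) x :=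
  FreeAlgebra.lift_ι_apply _ x

/-- Evaluation of `*`-polynomials at a family of elements of a unital `*`-algebra. -/
def eval {E : Type v} [Ring E] [Algebra ℂ E] [StarRing E] [StarModule ℂ E] (f : G → E) :
    FreeStar G →⋆ₐ[ℂ] E :=
  { evalAlg f with
    map_star' := fun x => by
      change evalAlg f (star x) = star (evalAlg f x)
      induction x using induct with
      | scalar c =>
        rw [star_scalar, AlgHom.commutes, AlgHom.commutes, algebraMap_star_comm]
      | letter x => rw [star_letter, evalAlg_letter, evalAlg_letter]; cases x <;> simp
      | mul a b ha hb => rw [star_mul, map_mul, map_mul, star_mul, ha, hb]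
      | add a b ha hb => rw [star_add, map_add, map_add, star_add, ha, hb] }

theorem eval_of {E : Type v} [Ring E] [Algebra ℂ E] [StarRing E] [StarModule ℂ E] (f : G → E)
    (g : G) : eval f (of g) = f g :=
  FreeAlgebra.lift_ι_apply (R := ℂ) (Sum.elim f (fun g => star (f g))) (Sum.inl g)

theorem letter_inr (g : G) : letter (Sum.inr g) = star (of g) := by
  rw [of, star_letter]; rfl

end FreeStar

/-! ## The universal unital C*-algebra on generators and relations -/

/-- The `C*`-seminorms on the free unital `*`-algebra modulo which the relations `R` hold. -/
structure AdmissibleSeminorm {G : Type u} (R : FreeStar G → FreeStar G → Prop) extends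
    Seminorm ℂ (FreeStar G) where
  mul_le : ∀ x y, toFun (x * y) ≤ toFun x * toFun y
  star_mul_self : ∀ x, toFun (star x * x) = toFun x * toFun x
  rel : ∀ x y, R x y → toFun (x - y) = 0

namespace AdmissibleSeminorm

variable {G : Type u} {R : FreeStar G → FreeStar G → Prop}

theorem star_le (q : AdmissibleSeminorm R) (x : FreeStar G) :
    q.toSeminorm (star x) ≤ q.toSeminorm x := by
  have h1 := q.star_mul_self (star x)
  have h2 := q.mul_le (star (star x)) (star x)
  have h3 := q.mul_le x (star x)
  rw [star_star] at h1 h2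
  change q.toSeminorm (x * star x) = q.toSeminorm (star x) * q.toSeminorm (star x) at h1
  change q.toSeminorm (x * star x) ≤ q.toSeminorm x * q.toSeminorm (star x) at h2
  rw [h1] at h2
  rcases (apply_nonneg q.toSeminorm (star x)).eq_or_lt with h | h
  · rw [← h]; exact apply_nonneg _ _
  · exact le_of_mul_le_mul_right h2 h

theorem star_eq (q : AdmissibleSeminorm R) (x : FreeStar G) :
    q.toSeminorm (star x) = q.toSeminorm x :=
  le_antisymm (q.star_le x) (by simpa using q.star_le (star x))

theorem eq_of_rel (q : AdmissibleSeminorm R) {x y : FreeStar G} (h : R x y) :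
    q.toSeminorm x = q.toSeminorm y := by
  have h0 : q.toSeminorm (x - y) = 0 := q.rel x y h
  have h1 := abs_sub_map_le_sub q.toSeminorm x y
  rw [h0] at h1
  exact sub_eq_zero.mp (abs_nonpos_iff.mp h1)

instance : Inhabited (AdmissibleSeminorm R) :=
  ⟨{ (0 : Seminorm ℂ (FreeStar G)) with
      mul_le := fun _ _ => (mul_zero (0 : ℝ)).ge
      star_mul_self := fun _ => (mul_zero (0 : ℝ)).symm
      rel := fun _ _ _ => rfl }⟩

/-- The seminorm of a representation in a unital C*-algebra that satisfies the relations. -/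
def ofEval {B : Type v} [CStarAlgebra B] (f : G → B)
    (hf : ∀ x y, R x y → FreeStar.eval f x = FreeStar.eval f y) : AdmissibleSeminorm R where
  toFun x := ‖FreeStar.eval f x‖
  map_zero' := by simp
  add_le' x y := by simpa using norm_add_le _ _
  neg' x := by simp
  smul' c x := by simp [norm_smul]
  mul_le x y := by simpa using norm_mul_le _ _
  star_mul_self x := by simp [map_star, CStarRing.norm_star_mul_self]
  rel x y h := by simp [hf x y h]

end AdmissibleSeminorm

/-- The relations bound the norms of the generators, so that a universal C*-algebra exists. -/
class BoundedRel {G : Type u} (R : FreeStar G → FreeStar G → Prop) : Prop where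
  bound : ∀ g, ∃ C : ℝ, ∀ q : AdmissibleSeminorm R, q.toSeminorm (FreeStar.of g) ≤ C

/-- The free unital `*`-algebra, to be equipped with the largest admissible seminorm. -/
def PreUniv {G : Type u} (_R : FreeStar G → FreeStar G → Prop) : Type u := FreeStar G

namespace PreUniv

variable {G : Type u} (R : FreeStar G → FreeStar G → Prop)

instance : Ring (PreUniv R) := inferInstanceAs (Ring (FreeStar G))

instance : Algebra ℂ (PreUniv R) := inferInstanceAs (Algebra ℂ (FreeStar G))

instance : StarRing (PreUniv R) := inferInstanceAs (StarRing (FreeStar G))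

instance : StarModule ℂ (PreUniv R) := inferInstanceAs (StarModule ℂ (FreeStar G))

set_option linter.unusedSectionVars false

variable [BoundedRel R]

theorem bddAbove (x : FreeStar G) :
    BddAbove (Set.range fun q : AdmissibleSeminorm R => q.toSeminorm x) := by
  suffices h : ∃ C : ℝ, ∀ q : AdmissibleSeminorm R, q.toSeminorm x ≤ C by
    obtain ⟨C, hC⟩ := h
    exact ⟨C, by rintro _ ⟨q, rfl⟩; exact hC q⟩
  have hone : ∀ q : AdmissibleSeminorm R, q.toSeminorm 1 ≤ 1 := by
    intro q
    have h : q.toSeminorm (star 1 * 1) = q.toSeminorm 1 * q.toSeminorm 1 := q.star_mul_self 1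
    rw [star_one, one_mul] at h
    nlinarith [sq_nonneg (q.toSeminorm 1 - 1)]
  induction x using FreeStar.induct with
  | scalar c =>
    refine ⟨‖c‖, fun q => ?_⟩
    rw [Algebra.algebraMap_eq_smul_one, map_smul_eq_mul]
    exact mul_le_of_le_one_right (norm_nonneg c) (hone q)
  | letter x =>
    rcases x with g | g
    · exact BoundedRel.bound g
    · obtain ⟨C, hC⟩ := BoundedRel.bound (R := R) g
      exact ⟨C, fun q => by rw [FreeStar.letter_inr, q.star_eq]; exact hC q⟩
  | mul a b ha hb =>
    obtain ⟨C, hC⟩ := ha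
    obtain ⟨D, hD⟩ := hb
    refine ⟨C * D, fun q => (q.mul_le a b).trans ?_⟩
    exact mul_le_mul (hC q) (hD q) (apply_nonneg q.toSeminorm b)
      ((apply_nonneg q.toSeminorm a).trans (hC q))
  | add a b ha hb =>
    obtain ⟨C, hC⟩ := ha
    obtain ⟨D, hD⟩ := hb
    exact ⟨C + D, fun q => (map_add_le_add q.toSeminorm a b).trans (add_le_add (hC q) (hD q))⟩

/-- The largest admissible seminorm: the supremum of all of them. -/
def maxNorm (x : FreeStar G) : ℝ := ⨆ q : AdmissibleSeminorm R, q.toSeminorm x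

theorem le_maxNorm (q : AdmissibleSeminorm R) (x : FreeStar G) :
    q.toSeminorm x ≤ maxNorm R x :=
  le_ciSup (bddAbove R x) q

theorem maxNorm_le {x : FreeStar G} {C : ℝ}
    (h : ∀ q : AdmissibleSeminorm R, q.toSeminorm x ≤ C) : maxNorm R x ≤ C :=
  ciSup_le h

theorem maxNorm_nonneg (x : FreeStar G) : 0 ≤ maxNorm R x :=
  (apply_nonneg _ x).trans (le_maxNorm R default x)

theorem maxNorm_smul_le (c : ℂ) (x : FreeStar G) : maxNorm R (c • x) ≤ ‖c‖ * maxNorm R x :=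
  maxNorm_le R fun q => by
    rw [map_smul_eq_mul]
    exact mul_le_mul_of_nonneg_left (le_maxNorm R q x) (norm_nonneg c)

theorem maxNorm_mul_le (x y : FreeStar G) : maxNorm R (x * y) ≤ maxNorm R x * maxNorm R y :=
  maxNorm_le R fun q => (q.mul_le x y).trans
    (mul_le_mul (le_maxNorm R q x) (le_maxNorm R q y) (apply_nonneg q.toSeminorm y)
      (maxNorm_nonneg R x))

theorem maxNorm_star (x : FreeStar G) : maxNorm R (star x) = maxNorm R x :=
  iSup_congr fun q => q.star_eq x

theorem maxNorm_star_mul_self (x : FreeStar G) :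
    maxNorm R x * maxNorm R x ≤ maxNorm R (star x * x) := by
  have h : maxNorm R x ≤ Real.sqrt (maxNorm R (star x * x)) :=
    maxNorm_le R fun q => Real.le_sqrt_of_sq_le (by
      rw [sq]
      exact (q.star_mul_self x).ge.trans (le_maxNorm R q (star x * x)))
  calc maxNorm R x * maxNorm R x
      ≤ Real.sqrt (maxNorm R (star x * x)) * Real.sqrt (maxNorm R (star x * x)) :=
        mul_self_le_mul_self (maxNorm_nonneg R x) h
    _ = maxNorm R (star x * x) := Real.mul_self_sqrt (maxNorm_nonneg R _)

instance : SeminormedAddCommGroup (PreUniv R) :=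
  AddGroupSeminorm.toSeminormedAddCommGroup
    { toFun := maxNorm R
      map_zero' := by
        refine le_antisymm (maxNorm_le R fun q => ?_) (maxNorm_nonneg R _)
        exact (map_zero q.toSeminorm).le
      add_le' := fun x y => maxNorm_le R fun q =>
        (map_add_le_add q.toSeminorm x y).trans
          (add_le_add (le_maxNorm R q x) (le_maxNorm R q y))
      neg' := fun x => iSup_congr fun q => map_neg_eq_map q.toSeminorm x }

theorem norm_def (x : PreUniv R) : ‖x‖ = maxNorm R x := rfl

instance : SeminormedRing (PreUniv R) where
  __ := (inferInstance : SeminormedAddCommGroup (PreUniv R))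
  __ := (inferInstance : Ring (PreUniv R))
  norm_mul_le := maxNorm_mul_le R

instance : NormedAlgebra ℂ (PreUniv R) where
  __ := (inferInstance : Algebra ℂ (PreUniv R))
  norm_smul_le := maxNorm_smul_le R

theorem norm_star' (x : PreUniv R) : ‖star x‖ = ‖x‖ := maxNorm_star R x

theorem norm_star_mul_self' (x : PreUniv R) : ‖x‖ * ‖x‖ ≤ ‖star x * x‖ :=
  maxNorm_star_mul_self R x

theorem isometry_star : Isometry (star : PreUniv R → PreUniv R) :=
  AddMonoidHomClass.isometry_of_norm (starAddEquiv : PreUniv R ≃+ PreUniv R) (norm_star' R)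

end PreUniv

/-- The universal unital C*-algebra on the generators `G` and the relations `R`: the Hausdorff
completion of the free unital `*`-algebra with respect to its largest admissible seminorm. -/
def UnivCStar {G : Type u} (R : FreeStar G → FreeStar G → Prop) [BoundedRel R] : Type u :=
  UniformSpace.Completion (PreUniv R)

namespace UnivCStar

open UniformSpace

variable {G : Type u} (R : FreeStar G → FreeStar G → Prop) [BoundedRel R]

instance : NormedRing (UnivCStar R) :=
  inferInstanceAs (NormedRing (Completion (PreUniv R)))

instance : CompleteSpace (UnivCStar R) :=
  inferInstanceAs (CompleteSpace (Completion (PreUniv R)))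

instance : Algebra ℂ (UnivCStar R) :=
  inferInstanceAs (Algebra ℂ (Completion (PreUniv R)))

instance : NormedAlgebra ℂ (UnivCStar R) where
  __ := (inferInstance : Algebra ℂ (UnivCStar R))
  norm_smul_le c x := norm_smul_le (β := Completion (PreUniv R)) c x

/-- The class of a `*`-polynomial in the universal C*-algebra. -/
def mk : FreeStar G →ₐ[ℂ] UnivCStar R where
  __ := (Completion.coeRingHom : PreUniv R →+* Completion (PreUniv R))
  commutes' _ := rfl

theorem mk_dense : DenseRange (mk R) := Completion.denseRange_coe (α := PreUniv R)

theorem norm_mk (x : FreeStar G) : ‖mk R x‖ = PreUniv.maxNorm R x :=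
  Completion.norm_coe (E := PreUniv R) x

/-- A closed property holds everywhere once it holds on classes of `*`-polynomials. -/
@[elab_as_elim]
theorem induct {R : FreeStar G → FreeStar G → Prop} [BoundedRel R] {p : UnivCStar R → Prop}
    (hp : IsClosed {x | p x}) (h : ∀ x, p (mk R x)) (x : UnivCStar R) : p x :=
  Completion.induction_on (α := PreUniv R) x hp h

instance : Star (UnivCStar R) :=
  ⟨Completion.map (star : PreUniv R → PreUniv R)⟩

theorem continuous_star' : Continuous (star : UnivCStar R → UnivCStar R) :=
  Completion.continuous_map (α := PreUniv R)

theorem star_mk (x : FreeStar G) : star (mk R x) = mk R (star x) :=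
  Completion.map_coe (PreUniv.isometry_star R).uniformContinuous x

instance : StarRing (UnivCStar R) where
  star_involutive x := by
    refine induct (isClosed_eq ?_ continuous_id) (fun x => ?_) x
    · exact (continuous_star' R).comp (continuous_star' R)
    · rw [star_mk, star_mk, star_star]
  star_mul x y := by
    refine induct (isClosed_eq ?_ ?_) (fun x => ?_) x
    · exact (continuous_star' R).comp (continuous_mul_const y)
    · exact continuous_const.mul (continuous_star' R)
    refine induct (isClosed_eq ?_ ?_) (fun y => ?_) y
    · exact (continuous_star' R).comp (continuous_const_mul _)
    · exact (continuous_star' R).mul continuous_const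
    · rw [← map_mul, star_mk, star_mk, star_mk, star_mul, map_mul]
  star_add x y := by
    refine induct (isClosed_eq ?_ ?_) (fun x => ?_) x
    · exact (continuous_star' R).comp (continuous_id.add continuous_const)
    · exact (continuous_star' R).add continuous_const
    refine induct (isClosed_eq ?_ ?_) (fun y => ?_) y
    · exact (continuous_star' R).comp (continuous_const.add continuous_id)
    · exact continuous_const.add (continuous_star' R)
    · rw [← map_add, star_mk, star_mk, star_mk, star_add, map_add]

instance : CStarAlgebra (UnivCStar R) where
  norm_mul_self_le x := by
    refine induct (isClosed_le ?_ ?_) (fun x => ?_) x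
    · exact continuous_norm.mul continuous_norm
    · exact continuous_norm.comp ((continuous_star' R).mul continuous_id)
    · rw [star_mk, ← map_mul, norm_mk, norm_mk]
      exact PreUniv.maxNorm_star_mul_self R x
  star_smul c x := by
    refine induct (isClosed_eq ?_ ?_) (fun x => ?_) x
    · exact (continuous_star' R).comp (continuous_const_smul c)
    · exact (continuous_star' R).const_smul (star c)
    · rw [← map_smul, star_mk, star_mk, star_smul, map_smul]

/-- The canonical generators. -/
def gen (g : G) : UnivCStar R := mk R (FreeStar.of g)

theorem eval_gen (x : FreeStar G) : FreeStar.eval (gen R) x = mk R x := by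
  induction x using FreeStar.induct with
  | scalar c => rw [AlgHomClass.commutes, AlgHomClass.commutes]
  | letter x =>
    rcases x with g | g
    · exact FreeStar.eval_of _ g
    · rw [FreeStar.letter_inr, map_star, ← star_mk]
      exact congrArg star (FreeStar.eval_of _ g)
  | mul a b ha hb => rw [map_mul, map_mul, ha, hb]
  | add a b ha hb => rw [map_add, map_add, ha, hb]

/-- The relations hold in the universal C*-algebra. -/
theorem mk_eq_of_rel {x y : FreeStar G} (h : R x y) : mk R x = mk R y := by
  rw [← sub_eq_zero, ← norm_eq_zero, ← map_sub, norm_mk]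
  exact le_antisymm (PreUniv.maxNorm_le R fun q => (q.rel x y h).le)
    (PreUniv.maxNorm_nonneg R _)

variable {R}

theorem norm_eval_le {B : Type v} [CStarAlgebra B] (f : G → B)
    (hf : ∀ x y, R x y → FreeStar.eval f x = FreeStar.eval f y) (x : FreeStar G) :
    ‖FreeStar.eval f x‖ ≤ ‖mk R x‖ := by
  rw [norm_mk]
  exact PreUniv.le_maxNorm R (AdmissibleSeminorm.ofEval f hf) x

/-- Evaluation of `*`-polynomials, on the seminormed algebra. -/
def evalPre {B : Type v} [CStarAlgebra B] (R : FreeStar G → FreeStar G → Prop) (f : G → B) :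
    PreUniv R →+* B :=
  RingHomClass.toRingHom (FreeStar.eval f : FreeStar G →⋆ₐ[ℂ] B)

theorem continuous_eval {B : Type v} [CStarAlgebra B] (f : G → B)
    (hf : ∀ x y, R x y → FreeStar.eval f x = FreeStar.eval f y) :
    Continuous (evalPre R f) :=
  AddMonoidHomClass.continuous_of_bound (evalPre R f) 1 (fun x => by
    rw [one_mul]
    exact (norm_eval_le f hf x).trans (norm_mk R x).le)

/-- The universal property: a family of elements of a unital C*-algebra that satisfies the
relations extends to a unital `*`-homomorphism. -/
def lift {B : Type v} [CStarAlgebra B] (f : G → B)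
    (hf : ∀ x y, R x y → FreeStar.eval f x = FreeStar.eval f y) : UnivCStar R →⋆ₐ[ℂ] B :=
  let F : UnivCStar R →+* B := Completion.extensionHom (evalPre R f) (continuous_eval f hf)
  have hF : ∀ x, F (mk R x) = FreeStar.eval f x := fun x =>
    Completion.extensionHom_coe _ (continuous_eval f hf) x
  have hc : Continuous F := Completion.continuous_extension
  { F with
    commutes' := fun c => (congrArg F ((mk R).commutes c).symm).trans
      ((hF _).trans (AlgHomClass.commutes _ c))
    map_star' := fun x => by
      change F (star x) = star (F x)
      refine induct (isClosed_eq ?_ ?_) (fun x => ?_) x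
      · exact hc.comp (continuous_star' R)
      · exact hc.star
      · rw [star_mk, hF, hF, map_star] }

theorem lift_mk {B : Type v} [CStarAlgebra B] (f : G → B)
    (hf : ∀ x y, R x y → FreeStar.eval f x = FreeStar.eval f y) (x : FreeStar G) :
    lift f hf (mk R x) = FreeStar.eval f x :=
  Completion.extensionHom_coe _ (continuous_eval f hf) x

theorem lift_gen {B : Type v} [CStarAlgebra B] (f : G → B)
    (hf : ∀ x y, R x y → FreeStar.eval f x = FreeStar.eval f y) (g : G) :
    lift f hf (gen R g) = f g :=
  (lift_mk f hf _).trans (FreeStar.eval_of f g)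

open scoped CStarAlgebra in
/-- Unital `*`-homomorphisms that agree on the generators are equal. -/
theorem hom_ext {B : Type v} [CStarAlgebra B] {φ ψ : UnivCStar R →⋆ₐ[ℂ] B}
    (h : ∀ g, φ (gen R g) = ψ (gen R g)) : φ = ψ := by
  have hmk : ∀ x, φ (mk R x) = ψ (mk R x) := by
    intro x
    induction x using FreeStar.induct with
    | scalar c => rw [AlgHom.commutes, AlgHomClass.commutes, AlgHomClass.commutes]
    | letter x =>
      rcases x with g | g
      · exact h g
      · rw [FreeStar.letter_inr, ← star_mk, map_star, map_star]
        exact congrArg star (h g)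
    | mul a b ha hb => rw [map_mul, map_mul, map_mul, ha, hb]
    | add a b ha hb => rw [map_add, map_add, map_add, ha, hb]
  ext x
  exact induct (p := fun x => φ x = ψ x)
    (isClosed_eq (map_continuous φ) (map_continuous ψ)) hmk x

end UnivCStar

/-! ## Subshifts -/

namespace Subshift

variable {𝓐 : Type u}

/-- Concatenation `αx` of a finite word and an infinite sequence. -/
def concat (α : List 𝓐) (x : ℕ → 𝓐) : ℕ → 𝓐 := fun n => α.getD n (x (n - α.length))

/-- The word of length `n` that occurs in `x` at position `i`. -/
def block (x : ℕ → 𝓐) (i n : ℕ) : List 𝓐 := List.ofFn fun k : Fin n => x (i + k)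

/-- The sequences no word of which belongs to the set `F` of forbidden words. -/
def avoiding (F : Set (List 𝓐)) : Set (ℕ → 𝓐) := {x | ∀ i n, block x i n ∉ F}

/-- A subshift is a set of sequences given by some set of forbidden words. -/
def IsSubshift (X : Set (ℕ → 𝓐)) : Prop := ∃ F : Set (List 𝓐), X = avoiding F

variable (X : Set (ℕ → 𝓐))

/-- The language of `X`: the finite words `x_0 ⋯ x_{n-1}` with `x ∈ X`. (For shift-invariant `X`
these are all the words that occur in elements of `X`.) -/
def language : Set (List 𝓐) := {w | ∃ x ∈ X, ∃ n, w = block x 0 n}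

/-- The set `C(α, β)` of the `βx ∈ X` with `αx ∈ X`, as a subset of `X`. -/
def C (α β : List 𝓐) : Set X := {y | ∃ x : ℕ → 𝓐, concat α x ∈ X ∧ (y : ℕ → 𝓐) = concat β x}

/-- The Boolean algebra of subsets of `X` generated by the `C(α, β)`, `α` and `β` in the
language. -/
def boolAlg : BooleanSubalgebra (Set X) :=
  BooleanSubalgebra.closure {A | ∃ α ∈ language X, ∃ β ∈ language X, A = C X α β}

variable {X} in
/-- `C(α, β)` as an element of the Boolean algebra. -/
def boolC {α β : List 𝓐} (hα : α ∈ language X) (hβ : β ∈ language X) : boolAlg X :=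
  ⟨C X α β, BooleanSubalgebra.subset_closure ⟨α, hα, β, hβ, rfl⟩⟩

/-- The product `s_α = s_{α_1} ⋯ s_{α_n}` along a word, with the empty product equal to `1`. -/
def word {E : Type v} [Monoid E] (s : 𝓐 → E) (α : List 𝓐) : E := (α.map s).prod

/-- Families of projections `p_A` and partial isometries `s_a` that satisfy the defining relations
of the unital subshift algebra. -/
structure IsFamily {E : Type v} [Ring E] [StarRing E] (p : boolAlg X → E) (s : 𝓐 → E) :
    Prop where
  isStarProjection : ∀ A, IsStarProjection (p A)
  isPartialIsometry : ∀ a, s a * star (s a) * s a = s a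
  map_top : p ⊤ = 1
  map_inf : ∀ A B, p (A ⊓ B) = p A * p B
  map_sup : ∀ A B, p (A ⊔ B) = p A + p B - p (A ⊓ B)
  map_bot : p ⊥ = 0
  map_C : ∀ (α β : List 𝓐) (hα : α ∈ language X) (hβ : β ∈ language X),
    word s β * star (word s α) * word s α * star (word s β) = p (boolC hα hβ)

/-- Generators of the unital subshift algebra: one for each `A` in the Boolean algebra and one for
each letter. -/
abbrev Gen : Type u := boolAlg X ⊕ 𝓐

/-- The free variable `p_A`. -/
abbrev pVar (A : boolAlg X) : FreeStar (Gen X) := FreeStar.of (Sum.inl A)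

/-- The free variable `s_a`. -/
abbrev sVar (a : 𝓐) : FreeStar (Gen X) := FreeStar.of (Sum.inr a)

/-- The defining relations of the unital subshift algebra, as pairs of `*`-polynomials. -/
inductive Rel : FreeStar (Gen X) → FreeStar (Gen X) → Prop
  | p_star (A) : Rel (star (pVar X A)) (pVar X A)
  | p_idem (A) : Rel (pVar X A * pVar X A) (pVar X A)
  | s_partial (a) : Rel (sVar X a * star (sVar X a) * sVar X a) (sVar X a)
  | p_top : Rel (pVar X ⊤) 1
  | p_inf (A B) : Rel (pVar X (A ⊓ B)) (pVar X A * pVar X B)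
  | p_sup (A B) : Rel (pVar X (A ⊔ B)) (pVar X A + pVar X B - pVar X (A ⊓ B))
  | p_bot : Rel (pVar X ⊥) 0
  | s_C (α β : List 𝓐) (hα : α ∈ language X) (hβ : β ∈ language X) :
      Rel (word (sVar X) β * star (word (sVar X) α) * word (sVar X) α * star (word (sVar X) β))
        (pVar X (boolC hα hβ))

instance : BoundedRel (Rel X) where
  bound g := by
    refine ⟨1, fun q => ?_⟩
    rcases g with A | a
    · have h : q.toSeminorm (star (pVar X A) * pVar X A) =
          q.toSeminorm (pVar X A) * q.toSeminorm (pVar X A) := q.star_mul_self _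
      have h1 : q.toSeminorm (star (pVar X A) * pVar X A - pVar X A * pVar X A) ≤
          q.toSeminorm (star (pVar X A) - pVar X A) * q.toSeminorm (pVar X A) := by
        rw [← sub_mul]; exact q.mul_le _ _
      have h2 : q.toSeminorm (star (pVar X A) - pVar X A) = 0 := q.rel _ _ (Rel.p_star A)
      have h3 := q.eq_of_rel (Rel.p_idem A)
      have h4 := abs_sub_map_le_sub q.toSeminorm (star (pVar X A) * pVar X A)
        (pVar X A * pVar X A)
      rw [h2, zero_mul] at h1
      have h5 := abs_nonpos_iff.mp (h4.trans h1)
      have h6 := apply_nonneg q.toSeminorm (pVar X A)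
      change q.toSeminorm (pVar X A) ≤ 1
      nlinarith [sq_nonneg (q.toSeminorm (pVar X A) - 1)]
    · have h : q.toSeminorm (star (sVar X a) * sVar X a) =
          q.toSeminorm (sVar X a) * q.toSeminorm (sVar X a) := q.star_mul_self _
      have h' : q.toSeminorm (star (star (sVar X a) * sVar X a) * (star (sVar X a) * sVar X a)) =
          q.toSeminorm (star (sVar X a) * sVar X a) *
            q.toSeminorm (star (sVar X a) * sVar X a) := q.star_mul_self _
      have e : star (star (sVar X a) * sVar X a) * (star (sVar X a) * sVar X a) =
          star (sVar X a) * (sVar X a * star (sVar X a) * sVar X a) := by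
        rw [star_mul, star_star]; simp only [mul_assoc]
      have h1 : q.toSeminorm (star (sVar X a) * (sVar X a * star (sVar X a) * sVar X a)) ≤
          q.toSeminorm (star (sVar X a)) *
            q.toSeminorm (sVar X a * star (sVar X a) * sVar X a) := q.mul_le _ _
      rw [q.star_eq, q.eq_of_rel (Rel.s_partial a), ← e, h', h] at h1
      have h6 := apply_nonneg q.toSeminorm (sVar X a)
      change q.toSeminorm (sVar X a) ≤ 1
      by_contra! hc
      generalize q.toSeminorm (sVar X a) = t at *
      nlinarith [mul_pos (mul_pos (by linarith : (0:ℝ) < t) (by linarith : (0:ℝ) < t))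
        (by nlinarith : (0:ℝ) < t * t - 1)]

/-- The unital subshift C*-algebra: the universal unital C*-algebra generated by projections
`p_A` and partial isometries `s_a` subject to the defining relations. -/
abbrev Alg : Type u := UnivCStar (Rel X)

/-- The projection `p_A`. -/
def p (A : boolAlg X) : Alg X := UnivCStar.gen (Rel X) (Sum.inl A)

/-- The partial isometry `s_a`. -/
def s (a : 𝓐) : Alg X := UnivCStar.gen (Rel X) (Sum.inr a)

theorem eval_word {E : Type v} [CStarAlgebra E] (f : Gen X → E) (α : List 𝓐) :
    FreeStar.eval f (word (sVar X) α) = word (fun a => f (Sum.inr a)) α := by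
  simp only [word, map_list_prod, List.map_map]
  congr 1
  exact List.map_congr_left fun a _ => FreeStar.eval_of f _

theorem eval_rel {E : Type v} [CStarAlgebra E] {p : boolAlg X → E} {s : 𝓐 → E}
    (h : IsFamily X p s) (x y : FreeStar (Gen X)) (hxy : Rel X x y) :
    FreeStar.eval (Sum.elim p s) x = FreeStar.eval (Sum.elim p s) y := by
  cases hxy with
  | p_star A => simpa [map_star, FreeStar.eval_of] using (h.isStarProjection A).isSelfAdjoint.star_eq
  | p_idem A => simpa [map_star, FreeStar.eval_of] using (h.isStarProjection A).isIdempotentElem.eq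
  | s_partial a => simpa [map_star, FreeStar.eval_of] using h.isPartialIsometry a
  | p_top => simpa [map_star, FreeStar.eval_of] using h.map_top
  | p_inf A B => simpa [map_star, FreeStar.eval_of] using h.map_inf A B
  | p_sup A B => simpa [map_star, FreeStar.eval_of] using h.map_sup A B
  | p_bot => simpa [map_star, FreeStar.eval_of] using h.map_bot
  | s_C α β hα hβ => simpa [map_star, FreeStar.eval_of, eval_word] using h.map_C α β hα hβ

/-- The generators of the unital subshift C*-algebra satisfy the defining relations. -/
theorem isFamily : IsFamily X (p X) (s X) := by
  have key : ∀ x y, Rel X x y → FreeStar.eval (UnivCStar.gen (Rel X)) x =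
      FreeStar.eval (UnivCStar.gen (Rel X)) y := fun x y h => by
    rw [UnivCStar.eval_gen, UnivCStar.eval_gen]; exact UnivCStar.mk_eq_of_rel _ h
  have hp : ∀ A, FreeStar.eval (UnivCStar.gen (Rel X)) (pVar X A) = p X A :=
    fun A => FreeStar.eval_of _ _
  have hs : ∀ a, FreeStar.eval (UnivCStar.gen (Rel X)) (sVar X a) = s X a :=
    fun a => FreeStar.eval_of _ _
  have hw : ∀ α, FreeStar.eval (UnivCStar.gen (Rel X)) (word (sVar X) α) = word (s X) α :=
    fun α => eval_word X _ α
  refine ⟨fun A => ⟨?_, ?_⟩, fun a => ?_, ?_, fun A B => ?_, fun A B => ?_, ?_,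
    fun α β hα hβ => ?_⟩
  · have h := key _ _ (Rel.p_idem A)
    rwa [map_mul, hp] at h
  · have h := key _ _ (Rel.p_star A)
    rwa [map_star, hp] at h
  · have h := key _ _ (Rel.s_partial a)
    rwa [map_mul, map_mul, map_star, hs] at h
  · have h := key _ _ Rel.p_top
    rwa [map_one, hp] at h
  · have h := key _ _ (Rel.p_inf A B)
    rwa [map_mul, hp, hp, hp] at h
  · have h := key _ _ (Rel.p_sup A B)
    rwa [map_sub, map_add, hp, hp, hp, hp] at h
  · have h := key _ _ Rel.p_bot
    rwa [map_zero, hp] at h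
  · have h := key _ _ (Rel.s_C α β hα hβ)
    rwa [map_mul, map_mul, map_mul, map_star, map_star, hw, hw, hp] at h

variable {X}

/-- The universal property of the unital subshift C*-algebra. -/
def lift {E : Type v} [CStarAlgebra E] {p : boolAlg X → E} {s : 𝓐 → E}
    (h : IsFamily X p s) : Alg X →⋆ₐ[ℂ] E :=
  UnivCStar.lift (Sum.elim p s) (eval_rel X h)

theorem lift_p {E : Type v} [CStarAlgebra E] {p : boolAlg X → E} {s : 𝓐 → E}
    (h : IsFamily X p s) (A : boolAlg X) : lift h (Subshift.p X A) = p A :=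
  UnivCStar.lift_gen _ (eval_rel X h) _

theorem lift_s {E : Type v} [CStarAlgebra E] {p : boolAlg X → E} {s : 𝓐 → E}
    (h : IsFamily X p s) (a : 𝓐) : lift h (Subshift.s X a) = s a :=
  UnivCStar.lift_gen _ (eval_rel X h) _

theorem hom_ext {E : Type v} [CStarAlgebra E] {φ ψ : Alg X →⋆ₐ[ℂ] E}
    (hp : ∀ A, φ (p X A) = ψ (p X A)) (hs : ∀ a, φ (s X a) = ψ (s X a)) : φ = ψ :=
  UnivCStar.hom_ext fun g => g.rec hp hs

theorem word_smul {E : Type v} [CStarAlgebra E] (z : ℂ) (s : 𝓐 → E) (α : List 𝓐) :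
    word (fun a => z • s a) α = z ^ α.length • word s α := by
  induction α with
  | nil => simp [word]
  | cons a α ih =>
    simp only [word, List.map_cons, List.prod_cons, List.length_cons] at ih ⊢
    rw [ih, smul_mul_smul_comm, pow_succ']

variable (X)

theorem circle_mul_star (z : Circle) : (z : ℂ) * star (z : ℂ) = 1 := by
  rw [Complex.star_def, Complex.mul_conj, Circle.normSq_coe, Complex.ofReal_one]

/-- Multiplying the partial isometries by a scalar of modulus one preserves the relations. -/
theorem isFamily_circle (z : Circle) : IsFamily X (p X) (fun a => (z : ℂ) • s X a) := by
  have h := isFamily X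
  refine ⟨h.isStarProjection, fun a => ?_, h.map_top, h.map_inf, h.map_sup, h.map_bot,
    fun α β hα hβ => ?_⟩
  · rw [star_smul, smul_mul_smul_comm, circle_mul_star, one_smul, mul_smul_comm,
      h.isPartialIsometry]
  · rw [word_smul, word_smul, star_smul, star_smul, smul_mul_smul_comm, smul_mul_smul_comm,
      smul_mul_smul_comm, h.map_C α β hα hβ, star_pow, star_pow]
    have e : (z : ℂ) ^ β.length * star (z : ℂ) ^ α.length * (z : ℂ) ^ α.length *
        star (z : ℂ) ^ β.length = ((z : ℂ) * star (z : ℂ)) ^ β.length *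
          ((z : ℂ) * star (z : ℂ)) ^ α.length := by ring
    rw [e, circle_mul_star, one_pow, one_pow, one_mul, one_smul]

/-- The endomorphism with `p_A ↦ p_A` and `s_a ↦ z s_a`. -/
def gaugeHom (z : Circle) : Alg X →⋆ₐ[ℂ] Alg X := lift (isFamily_circle X z)

theorem gaugeHom_p (z : Circle) (A : boolAlg X) : gaugeHom X z (p X A) = p X A :=
  lift_p _ A

theorem gaugeHom_s (z : Circle) (a : 𝓐) : gaugeHom X z (s X a) = (z : ℂ) • s X a :=
  lift_s _ a

theorem gaugeHom_one : gaugeHom X 1 = StarAlgHom.id ℂ (Alg X) :=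
  hom_ext (fun A => gaugeHom_p X 1 A) (fun a => by rw [gaugeHom_s]; simp)

theorem gaugeHom_mul (z w : Circle) :
    gaugeHom X (z * w) = (gaugeHom X z).comp (gaugeHom X w) :=
  hom_ext (fun A => by simp [gaugeHom_p])
    (fun a => by simp [gaugeHom_s, smul_smul, mul_comm])

/-- The gauge action of the circle on the unital subshift C*-algebra: `γ_z` is the
`*`-automorphism with `γ_z(p_A) = p_A` and `γ_z(s_a) = z s_a`. -/
def gauge : Circle →* (Alg X ≃⋆ₐ[ℂ] Alg X) where
  toFun z := StarAlgEquiv.ofStarAlgHom (gaugeHom X z) (gaugeHom X z⁻¹)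
    (by rw [← gaugeHom_mul, inv_mul_cancel, gaugeHom_one])
    (by rw [← gaugeHom_mul, mul_inv_cancel, gaugeHom_one])
  map_one' := StarAlgEquiv.ext fun x => DFunLike.congr_fun (gaugeHom_one X) x
  map_mul' z w := StarAlgEquiv.ext fun x => DFunLike.congr_fun (gaugeHom_mul X z w) x

theorem gauge_p (z : Circle) (A : boolAlg X) : gauge X z (p X A) = p X A := gaugeHom_p X z A

theorem gauge_s (z : Circle) (a : 𝓐) : gauge X z (s X a) = (z : ℂ) • s X a := gaugeHom_s X z a

end Subshift

end

/-! The kernel of `Φ` is gauge-invariant, because `Φ ∘ γ_z = β_z ∘ Φ`. If `Φ x = 0`, then `Φ` kills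
every `γ_z(x^* x)`, hence also the average of `x^* x` over the circle. That average lies in the
closure of the core, the span of the `s_α p_A s_β^*` with `|α| = |β|`
(`integral_gauge_mem_closure_core`). `Φ` is isometric on the core (`IsFamily.norm_map_of_mem_core`),
so the average is zero. Averaging is faithful on positive elements
(`eq_zero_of_integral_star_mul_self_eq_zero`), and so `x = 0`.

The substance is the isometry on the core. The relation `p_A s_a = s_a p_{A'}`
(`IsFamily.exists_p_mul_s`) makes the `s_α p_A s_β^*` span a `*`-algebra, and makes words of equal
length orthogonal unless they coincide. For an infinite alphabet the `s_a s_a^*` need not add up to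
`1`, so words of different lengths cannot simply be extended to a common length. Instead a finite
set `T` of letters and a length `n` are fixed, and reading stops at length `n` or when the next
letter lies outside `T`. The resulting `stoppedWord`s have pairwise orthogonal ranges and source
projections among the `p_A`.

Every element of the core then lies in the span of some `w_i p_A w_j^*`, in fact in a
finite-dimensional `*`-algebra of such elements. There injectivity reduces to the matrix entries,
which are combinations of the commuting projections `p_A`; these are handled by cutting `X` into
pieces on which each combination is scalar. An injective `*`-homomorphism on a C*-algebra is
isometric. -/

namespace Subshift

universe w

/-! ### Words, sequences and the sets `C(α, β)`. -/

section Words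

variable {𝓐 : Type u} {X : Set (ℕ → 𝓐)}

theorem concat_nil (x : ℕ → 𝓐) : concat [] x = x := by
  funext n; simp [concat]

theorem concat_append (α β : List 𝓐) (x : ℕ → 𝓐) :
    concat (α ++ β) x = concat α (concat β x) := by
  funext n
  simp only [concat, List.length_append]
  rcases lt_or_ge n α.length with hn | hn
  · rw [List.getD_append _ _ _ _ hn, List.getD_eq_getElem _ _ hn, List.getD_eq_getElem _ _ hn]
  · rw [List.getD_append_right _ _ _ _ hn, List.getD_eq_default _ _ hn, Nat.sub_sub]

theorem concat_singleton_zero (a : 𝓐) (x : ℕ → 𝓐) : concat [a] x 0 = a := by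
  simp [concat]

theorem block_concat (α : List 𝓐) (x : ℕ → 𝓐) : block (concat α x) 0 α.length = α := by
  apply List.ext_getElem <;> simp +contextual [block, concat]

theorem mem_language_of_concat_mem {α : List 𝓐} {x : ℕ → 𝓐} (h : concat α x ∈ X) :
    α ∈ language X :=
  ⟨_, h, _, (block_concat α x).symm⟩

theorem concat_block (x : ℕ → 𝓐) (n : ℕ) : concat (block x 0 n) (fun k => x (k + n)) = x := by
  funext k
  simp only [concat, block, List.length_ofFn]
  rcases lt_or_ge k n with hk | hk
  · rw [List.getD_eq_getElem _ _ (by simpa using hk)]; simp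
  · rw [List.getD_eq_default _ _ (by simpa using hk), Nat.sub_add_cancel hk]

theorem mem_language_iff {α : List 𝓐} : α ∈ language X ↔ ∃ x, concat α x ∈ X := by
  refine ⟨?_, fun ⟨x, hx⟩ => mem_language_of_concat_mem hx⟩
  rintro ⟨x, hx, n, rfl⟩
  exact ⟨_, (concat_block x n).symm ▸ hx⟩

theorem IsSubshift.shift_mem (hX : IsSubshift X) {x : ℕ → 𝓐} (hx : x ∈ X) (n : ℕ) :
    (fun k => x (k + n)) ∈ X := by
  obtain ⟨F, rfl⟩ := hX
  intro i m
  have h := hx (i + n) m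
  have e : block (fun k => x (k + n)) i m = block x (i + n) m := by
    simp only [block]; congr 1; funext k; congr 1; omega
  rwa [e]

theorem IsSubshift.mem_of_concat_mem (hX : IsSubshift X) {α : List 𝓐} {x : ℕ → 𝓐}
    (h : concat α x ∈ X) : x ∈ X := by
  have e : (fun k => concat α x (k + α.length)) = x := by
    funext k; simp [concat]
  exact e ▸ hX.shift_mem h α.length

theorem nil_mem_language (hne : X.Nonempty) : [] ∈ language X := by
  obtain ⟨x, hx⟩ := hne
  exact mem_language_iff.mpr ⟨x, by rwa [concat_nil]⟩

/-- `language` only records prefixes, so an occurrence at position `n` has to be shifted to position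
`0`. -/
theorem IsSubshift.singleton_mem_language (hX : IsSubshift X) {a : 𝓐}
    (ha : ∃ x ∈ X, ∃ n, x n = a) : [a] ∈ language X := by
  obtain ⟨x, hx, n, rfl⟩ := ha
  exact ⟨_, hX.shift_mem hx n, 1, by simp [block]⟩

theorem IsSubshift.mem_language_of_cons (hX : IsSubshift X) {a : 𝓐} {α : List 𝓐}
    (h : a :: α ∈ language X) : α ∈ language X := by
  obtain ⟨x, hx⟩ := mem_language_iff.mp h
  rw [show a :: α = [a] ++ α from rfl, concat_append] at hx
  exact mem_language_of_concat_mem (hX.mem_of_concat_mem hx)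

theorem C_nil_singleton_inter {a b : 𝓐} (hab : a ≠ b) : C X [] [a] ∩ C X [] [b] = ∅ := by
  rw [Set.eq_empty_iff_forall_notMem]
  rintro y ⟨⟨x, -, hx⟩, ⟨x', -, hx'⟩⟩
  apply hab
  rw [← concat_singleton_zero a x, ← concat_singleton_zero b x', ← hx, ← hx']

/-- A point `y` of the intersection begins with `a` and satisfies `αy ∈ X`, so `αy` has prefix `αa`.
This is what makes `s_α` vanish for words outside the language, about which relation 2 says nothing.
-/
theorem C_nil_inter_C_singleton {α : List 𝓐} {a : 𝓐} (h : α ++ [a] ∉ language X) :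
    C X α [] ∩ C X [] [a] = ∅ := by
  rw [Set.eq_empty_iff_forall_notMem]
  rintro y ⟨⟨x, hx, hy⟩, ⟨x', -, hy'⟩⟩
  apply h
  refine mem_language_of_concat_mem (x := x') ?_
  rw [concat_append, ← hy', hy, concat_nil]
  exact hx

end Words

/-! ### Consequences of the defining relations. -/

section Family

variable {𝓐 : Type u} {X : Set (ℕ → 𝓐)} {E : Type v}

theorem word_nil [Monoid E] (s : 𝓐 → E) : word s [] = 1 := by simp [word]

theorem word_cons [Monoid E] (s : 𝓐 → E) (a : 𝓐) (α : List 𝓐) :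
    word s (a :: α) = s a * word s α := by simp [word]

theorem word_append [Monoid E] (s : 𝓐 → E) (α β : List 𝓐) :
    word s (α ++ β) = word s α * word s β := by simp [word]

theorem word_singleton [Monoid E] (s : 𝓐 → E) (a : 𝓐) : word s [a] = s a := by simp [word]

open Classical in
/-- The follower set `{x ∈ X : αx ∈ X}` of a word, as an element of the Boolean algebra. -/
noncomputable def follower (hne : X.Nonempty) (α : List 𝓐) : boolAlg X :=
  if h : α ∈ language X then boolC h (nil_mem_language hne) else ⊥

/-- The cylinder set of a letter, as an element of the Boolean algebra. -/
noncomputable def cylinder (hX : IsSubshift X) (hne : X.Nonempty)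
    (hletters : ∀ a : 𝓐, ∃ x ∈ X, ∃ n, x n = a) (a : 𝓐) : boolAlg X :=
  boolC (nil_mem_language hne) (hX.singleton_mem_language (hletters a))

theorem disjoint_cylinder (hX : IsSubshift X) (hne : X.Nonempty)
    (hletters : ∀ a : 𝓐, ∃ x ∈ X, ∃ n, x n = a) {a b : 𝓐} (hab : a ≠ b) :
    cylinder hX hne hletters a ⊓ cylinder hX hne hletters b = ⊥ :=
  Subtype.ext (C_nil_singleton_inter hab)

/-- With `e = t^* t`, the element `(te - t)^* (te - t)` equals `e³ - 2e² + e = 0`; the C*-identity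
does the rest. -/
theorem mul_star_mul_self_of_isIdempotentElem [CStarAlgebra E] {t : E}
    (ht : IsIdempotentElem (star t * t)) : t * (star t * t) = t := by
  rw [← sub_eq_zero, ← CStarRing.star_mul_self_eq_zero_iff]
  have h : star t * t * (star t * t) = star t * t := ht
  simp only [star_sub, star_mul, star_star, sub_mul, mul_sub]
  simp only [mul_assoc] at h ⊢
  simp [h]

namespace IsFamily

variable [CStarAlgebra E] {p : boolAlg X → E} {s : 𝓐 → E}

theorem star_p (h : IsFamily X p s) (A : boolAlg X) : star (p A) = p A :=
  (h.isStarProjection A).isSelfAdjoint.star_eq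

theorem p_mul_self (h : IsFamily X p s) (A : boolAlg X) : p A * p A = p A :=
  (h.isStarProjection A).isIdempotentElem.eq

theorem p_comm (h : IsFamily X p s) (A B : boolAlg X) : p A * p B = p B * p A := by
  rw [← h.map_inf, inf_comm, h.map_inf]

theorem p_compl (h : IsFamily X p s) (A : boolAlg X) : p Aᶜ = 1 - p A := by
  have h1 := h.map_sup A Aᶜ
  rw [sup_compl_eq_top, inf_compl_eq_bot, h.map_top, h.map_bot, sub_zero] at h1
  rw [h1, add_sub_cancel_left]

theorem s_mul_star (h : IsFamily X p s) (hX : IsSubshift X) (hne : X.Nonempty)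
    (hletters : ∀ a : 𝓐, ∃ x ∈ X, ∃ n, x n = a) (a : 𝓐) :
    s a * star (s a) = p (cylinder hX hne hletters a) := by
  have h1 := h.map_C [] [a] (nil_mem_language hne) (hX.singleton_mem_language (hletters a))
  rw [cylinder, ← h1]
  simp [word_nil, word_singleton]

theorem star_word_mul_word_of_mem (h : IsFamily X p s) (hne : X.Nonempty) {α : List 𝓐}
    (hα : α ∈ language X) :
    star (word s α) * word s α = p (boolC hα (nil_mem_language hne)) := by
  have h1 := h.map_C α [] hα (nil_mem_language hne)
  simpa [word_nil] using h1

/-- Induction on the last letter. If `α` is in the language but `αa` is not, then inserting the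
source projection of `s_α` and the range projection of `s_a` between the two factors produces the
projection of an empty intersection. -/
theorem word_eq_zero (h : IsFamily X p s) (hX : IsSubshift X) (hne : X.Nonempty)
    (hletters : ∀ a : 𝓐, ∃ x ∈ X, ∃ n, x n = a) {α : List 𝓐} (hα : α ∉ language X) :
    word s α = 0 := by
  induction α using List.reverseRecOn with
  | nil => exact absurd (nil_mem_language hne) hα
  | append_singleton α a ih =>
    rw [word_append, word_singleton]
    by_cases hα' : α ∈ language X
    · have h1 := h.star_word_mul_word_of_mem hne hα'
      have h2 := mul_star_mul_self_of_isIdempotentElem (t := word s α)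
        (by rw [h1]; exact h.p_mul_self _)
      have h3 : p (boolC hα' (nil_mem_language hne)) * p (cylinder hX hne hletters a) = 0 := by
        rw [← h.map_inf, ← h.map_bot]
        exact congrArg p (Subtype.ext (C_nil_inter_C_singleton hα))
      rw [h1] at h2
      rw [← h2, ← h.isPartialIsometry a, h.s_mul_star hX hne hletters, mul_assoc,
        ← mul_assoc (p _) (p _), h3, zero_mul, mul_zero]
    · rw [ih hα', zero_mul]

/-- The default value `⊥` of `follower` outside the language agrees with `s_α = 0` there, so later
arguments need no membership hypothesis on words. -/
theorem star_word_mul_word (h : IsFamily X p s) (hX : IsSubshift X) (hne : X.Nonempty)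
    (hletters : ∀ a : 𝓐, ∃ x ∈ X, ∃ n, x n = a) (α : List 𝓐) :
    star (word s α) * word s α = p (follower hne α) := by
  by_cases hα : α ∈ language X
  · rw [follower, dif_pos hα, h.star_word_mul_word_of_mem hne hα]
  · rw [follower, dif_neg hα, h.word_eq_zero hX hne hletters hα, mul_zero, h.map_bot]

theorem star_s_mul_s (h : IsFamily X p s) (hX : IsSubshift X) (hne : X.Nonempty)
    (hletters : ∀ a : 𝓐, ∃ x ∈ X, ∃ n, x n = a) {a b : 𝓐} (hab : a ≠ b) :
    star (s a) * s b = 0 := by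
  have h1 : star (s a) * (s a * star (s a)) = star (s a) := by
    have := congrArg star (h.isPartialIsometry a)
    simpa [star_mul, mul_assoc] using this
  rw [← h1, ← h.isPartialIsometry b, h.s_mul_star hX hne hletters, h.s_mul_star hX hne hletters,
    mul_assoc, ← mul_assoc (p _) (p _), ← h.map_inf, disjoint_cylinder hX hne hletters hab,
    h.map_bot, zero_mul, mul_zero]

/-- The condition `ax ∈ A` on `x` is again given by a set in the Boolean algebra. It suffices to
find `A'` for the generators and to pass through unions and complements. Only the existence of `A'`
matters later. -/
theorem exists_p_mul_s (h : IsFamily X p s) (hX : IsSubshift X) (hne : X.Nonempty)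
    (hletters : ∀ a : 𝓐, ∃ x ∈ X, ∃ n, x n = a) (A : boolAlg X) (a : 𝓐) :
    ∃ A', p A * s a = s a * p A' := by
  obtain ⟨A, hA⟩ := A
  induction hA using BooleanSubalgebra.closure_bot_sup_induction with
  | mem x hx =>
    obtain ⟨α, hα, β, hβ, rfl⟩ := hx
    have hC := h.map_C α β hα hβ
    change ∃ A', p (boolC hα hβ) * s a = s a * p A'
    rw [← hC]
    cases β with
    | nil =>
      -- For `β` empty, `p_A = s_α^* s_α` commutes with `s_a s_a^*`, so `p_A s_a = s_a (s_a^* s_α^*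
      -- s_α s_a)`, and the bracket is the source projection of `s_{αa}`.
      refine ⟨follower hne (α ++ [a]), ?_⟩
      have h1 := h.star_word_mul_word hX hne hletters α
      have h2 := h.star_word_mul_word hX hne hletters (α ++ [a])
      rw [word_append, word_singleton, star_mul, mul_assoc, ← mul_assoc _ (word s α), h1] at h2
      rw [← h2, word_nil, one_mul, star_one, mul_one, h1, ← mul_assoc, ← mul_assoc,
        h.s_mul_star hX hne hletters, h.p_comm, mul_assoc, ← h.s_mul_star hX hne hletters,
        h.isPartialIsometry]
    | cons b β =>
      rw [word_cons, star_mul]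
      by_cases hab : b = a
      · subst hab
        have hC' := h.map_C α β hα (hX.mem_language_of_cons hβ)
        -- The leading `s_b` is already in place, the middle is `p` of `C(α, β)` for the shortened
        -- `β`, and the trailing `s_b^* s_b` is `p` of the follower set of `b`.
        refine ⟨boolC hα (hX.mem_language_of_cons hβ) ⊓ follower hne [b], ?_⟩
        rw [h.map_inf, ← hC', ← h.star_word_mul_word hX hne hletters, word_singleton]
        simp only [mul_assoc]
      · refine ⟨⊥, ?_⟩
        rw [h.map_bot, mul_zero, mul_assoc, mul_assoc (star (word s β)),
          h.star_s_mul_s hX hne hletters hab, mul_zero, mul_zero]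
  | bot =>
    refine ⟨⊥, ?_⟩
    change p ⊥ * s a = _
    rw [h.map_bot, mul_zero, zero_mul]
  | sup x hx y hy ihx ihy =>
    obtain ⟨A', hA'⟩ := ihx
    obtain ⟨B', hB'⟩ := ihy
    refine ⟨A' ⊔ B', ?_⟩
    change p (⟨x, hx⟩ ⊔ ⟨y, hy⟩) * s a = _
    rw [h.map_sup, h.map_sup, h.map_inf, h.map_inf, sub_mul, add_mul, hA', hB', mul_assoc, hB',
      ← mul_assoc, hA', mul_assoc, mul_sub, mul_add]
  | compl x hx ih =>
    obtain ⟨A', hA'⟩ := ih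
    refine ⟨A'ᶜ, ?_⟩
    change p (⟨x, hx⟩)ᶜ * s a = _
    rw [h.p_compl, h.p_compl, sub_mul, hA', mul_sub, one_mul, mul_one]

theorem exists_p_mul_word (h : IsFamily X p s) (hX : IsSubshift X) (hne : X.Nonempty)
    (hletters : ∀ a : 𝓐, ∃ x ∈ X, ∃ n, x n = a) (A : boolAlg X) (α : List 𝓐) :
    ∃ A', p A * word s α = word s α * p A' := by
  induction α generalizing A with
  | nil => exact ⟨A, by rw [word_nil, one_mul, mul_one]⟩
  | cons a α ih =>
    obtain ⟨B, hB⟩ := h.exists_p_mul_s hX hne hletters A a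
    obtain ⟨A', hA'⟩ := ih B
    exact ⟨A', by rw [word_cons, ← mul_assoc, hB, mul_assoc, hA', mul_assoc]⟩

/-- A common first letter contributes the projection `s_a^* s_a`, which moves to the right past the
remaining word; the first letters that differ give zero. -/
theorem star_word_mul_word_of_length_eq (h : IsFamily X p s) (hX : IsSubshift X)
    (hne : X.Nonempty) (hletters : ∀ a : 𝓐, ∃ x ∈ X, ∃ n, x n = a) {α β : List 𝓐}
    (hl : α.length = β.length) (hαβ : α ≠ β) : star (word s α) * word s β = 0 := by
  induction α generalizing β with
  | nil => exact absurd (List.length_eq_zero_iff.mp hl.symm).symm hαβ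
  | cons a α ih =>
    cases β with
    | nil => simp at hl
    | cons b β =>
      rw [word_cons, word_cons, star_mul, mul_assoc, ← mul_assoc (star (s a))]
      by_cases hab : a = b
      · subst hab
        obtain ⟨A', hA'⟩ := h.exists_p_mul_word hX hne hletters (follower hne [a]) β
        have h1 := h.star_word_mul_word hX hne hletters [a]
        rw [word_singleton] at h1
        rw [h1, hA', ← mul_assoc, ih (by simpa using hl) (fun e => hαβ (e ▸ rfl)), zero_mul]
      · rw [h.star_s_mul_s hX hne hletters hab, zero_mul, mul_zero]

end IsFamily

end Family

/-! ### Isometry on spans of matrix units over the commuting projections. -/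

section MatrixUnits

variable {𝓐 : Type u} {X : Set (ℕ → 𝓐)} {E : Type v} [CStarAlgebra E]
  {p : boolAlg X → E} {s : 𝓐 → E} {B : Type w} [NonUnitalCStarAlgebra B] (Φ : E →⋆ₙₐ[ℂ] B)

namespace IsFamily

/-- A `*`-homomorphism that kills no `p A` with `A ≠ ⊥` is injective on their linear span. -/
theorem eq_zero_of_mem_span_range_p (h : IsFamily X p s) (hΦ : ∀ A, A ≠ ⊥ → Φ (p A) ≠ 0)
    {d : E} (hd : d ∈ Submodule.span ℂ (Set.range p)) (h0 : Φ d = 0) : d = 0 := by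
  -- The claim is localized to a set `A`, with a separate scalar `c`, so that induction works. A
  -- generator `p C` acts as `1` on `A ⊓ C` and as `0` on `A ⊓ Cᶜ`, so it is absorbed into the
  -- scalar on each piece. When no generator is left, the element is `c • p A`, and `Φ (p A) ≠ 0`
  -- unless `A = ⊥`.
  have key : ∀ t : Finset E, (t : Set E) ⊆ Set.range p → ∀ d ∈ Submodule.span ℂ (t : Set E),
      ∀ (c : ℂ) (A : boolAlg X), Φ (c • p A + p A * d) = 0 → c • p A + p A * d = 0 := by
    classical
    intro t
    induction t using Finset.induction_on with
    | empty =>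
      intro _ d hd c A h0
      obtain rfl : d = 0 := by simpa using hd
      rw [mul_zero, add_zero] at h0 ⊢
      by_cases hA : A = ⊥
      · rw [hA, h.map_bot, smul_zero]
      · rw [map_smul, smul_eq_zero, or_iff_left (hΦ A hA)] at h0
        rw [h0, zero_smul]
    | insert v t hv ih =>
      intro ht d hd c A h0
      rw [Finset.coe_insert] at ht hd
      obtain ⟨r, d', hd', rfl⟩ := Submodule.mem_span_insert.mp hd
      obtain ⟨C, rfl⟩ := ht (Set.mem_insert v _)
      have ih := ih ((Set.subset_insert _ _).trans ht) d' hd'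
      have e1 : p C * (c • p A + p A * (r • p C + d')) =
          (c + r) • p (A ⊓ C) + p (A ⊓ C) * d' := by
        have h2 : p A * p C * p C = p A * p C := by rw [mul_assoc, h.p_mul_self]
        simp only [h.map_inf, mul_add, mul_smul_comm, ← mul_assoc, h.p_comm C A, h2, add_smul]
        abel
      have e2 : p Cᶜ * (c • p A + p A * (r • p C + d')) =
          c • p (A ⊓ Cᶜ) + p (A ⊓ Cᶜ) * d' := by
        have h1 : p A * p Cᶜ * p C = 0 := by
          rw [mul_assoc, ← h.map_inf, inf_comm, inf_compl_eq_bot, h.map_bot, mul_zero]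
        rw [h.map_inf, mul_add, mul_add, mul_smul_comm, mul_smul_comm, mul_add, mul_smul_comm,
          ← mul_assoc, ← mul_assoc, h.p_comm Cᶜ A, h1, smul_zero, zero_add]
      have z1 := ih (c + r) (A ⊓ C) (by rw [← e1, map_mul, h0, mul_zero])
      have z2 := ih c (A ⊓ Cᶜ) (by rw [← e2, map_mul, h0, mul_zero])
      rw [← one_mul (c • p A + _), ← add_sub_cancel (p C) 1, ← h.p_compl, add_mul, e1, e2, z1, z2,
        add_zero]
  obtain ⟨t, ht, hdt⟩ := Submodule.mem_span_finite_of_mem_span hd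
  have := key t ht d hdt 0 ⊤ (by rwa [zero_smul, zero_add, h.map_top, one_mul])
  rwa [zero_smul, zero_add, h.map_top, one_mul] at this

variable {ι : Type u} {w : ι → E} {D : ι → boolAlg X}

theorem matrixUnit_mul_p (h : IsFamily X p s) (hw : ∀ i, star (w i) * w i = p (D i)) (i : ι) :
    w i * p (D i) = w i := by
  rw [← hw]
  exact mul_star_mul_self_of_isIdempotentElem (by rw [hw]; exact h.p_mul_self _)

/-- A `*`-homomorphism that kills no `p A` with `A ≠ ⊥` is injective on the span of the
`w i * p A * star (w j)`, for partial isometries `w i` with orthogonal ranges. -/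
theorem eq_zero_of_mem_span_matrixUnit [Finite ι] (h : IsFamily X p s) (hΦ : ∀ A, A ≠ ⊥ → Φ (p A) ≠ 0)
    (hw : ∀ i, star (w i) * w i = p (D i)) (hw' : ∀ i j, i ≠ j → star (w i) * w j = 0)
    {x : E} (hx : x ∈ Submodule.span ℂ {y | ∃ i j A, y = w i * p A * star (w j)})
    (h0 : Φ x = 0) : x = 0 := by
  classical
  have := Fintype.ofFinite ι
  -- The matrix entries of `x` lie in the commutative span of projections, where injectivity is
  -- known.
  have hcomp : ∀ i j, star (w i) * x * w j ∈ Submodule.span ℂ (Set.range p) := by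
    intro i j
    clear h0
    induction hx using Submodule.span_induction with
    | mem y hy =>
      obtain ⟨k, l, A, rfl⟩ := hy
      rw [show star (w i) * (w k * p A * star (w l)) * w j =
        (star (w i) * w k) * p A * (star (w l) * w j) by simp only [mul_assoc]]
      by_cases hik : i = k
      · by_cases hlj : l = j
        · subst hik hlj
          rw [hw, hw, ← h.map_inf, ← h.map_inf]
          exact Submodule.subset_span ⟨_, rfl⟩
        · rw [hw' _ _ hlj, mul_zero]; exact zero_mem _
      · rw [hw' _ _ hik, zero_mul, zero_mul]; exact zero_mem _
    | zero => simp
    | add y z _ _ hy hz => rw [mul_add, add_mul]; exact add_mem hy hz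
    | smul c y _ hy => rw [mul_smul_comm, smul_mul_assoc]; exact Submodule.smul_mem _ c hy
  have hz : ∀ i j, star (w i) * x * w j = 0 := fun i j =>
    h.eq_zero_of_mem_span_range_p Φ hΦ (hcomp i j)
      (by rw [map_mul, map_mul, h0, mul_zero, zero_mul])
  have hQ : ∀ i, (∑ k, w k * star (w k)) * w i = w i := by
    intro i
    rw [Finset.sum_mul, Finset.sum_eq_single i, mul_assoc, hw, h.matrixUnit_mul_p hw]
    · intro k _ hk
      rw [mul_assoc, hw' k i hk, mul_zero]
    · simp
  have hQ' : ∀ i, star (w i) * (∑ k, w k * star (w k)) = star (w i) := by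
    intro i
    have := congrArg star (hQ i)
    simpa [star_sum] using this
  -- The sum of the range projections is a two-sided unit for `x`, so `x` is recovered from its
  -- entries.
  have hrec : (∑ k, w k * star (w k)) * x * (∑ k, w k * star (w k)) = x := by
    clear h0 hz hcomp
    induction hx using Submodule.span_induction with
    | mem y hy =>
      obtain ⟨k, l, A, rfl⟩ := hy
      rw [← mul_assoc, ← mul_assoc, hQ, mul_assoc _ (star (w l)), hQ']
    | zero => simp
    | add y z _ _ hy hz => rw [mul_add, add_mul, hy, hz]
    | smul c y _ hy => rw [mul_smul_comm, smul_mul_assoc, hy]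
  rw [← hrec, Finset.sum_mul, Finset.sum_mul]
  refine Finset.sum_eq_zero fun i _ => ?_
  rw [Finset.mul_sum]
  refine Finset.sum_eq_zero fun j _ => ?_
  rw [show w i * star (w i) * x * (w j * star (w j)) =
    w i * (star (w i) * x * w j) * star (w j) by simp only [mul_assoc], hz, mul_zero, zero_mul]

/-- A `*`-homomorphism that kills no `p A` with `A ≠ ⊥` is isometric on the span of the
`w i * p A * star (w j)`, for partial isometries `w i` with orthogonal ranges. -/
theorem norm_map_of_mem_span_matrixUnit [Finite ι] (h : IsFamily X p s) (hΦ : ∀ A, A ≠ ⊥ → Φ (p A) ≠ 0)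
    (hw : ∀ i, star (w i) * w i = p (D i)) (hw' : ∀ i j, i ≠ j → star (w i) * w j = 0)
    {x : E} (hx : x ∈ Submodule.span ℂ {y | ∃ i j A, y = w i * p A * star (w j)}) :
    ‖Φ x‖ = ‖x‖ := by
  classical
  have := Fintype.ofFinite ι
  obtain ⟨t, ht, hxt⟩ := Submodule.mem_span_finite_of_mem_span hx
  have ht' : ∀ y ∈ t, ∃ A, ∃ i j, y = w i * p A * star (w j) := fun y hy => by
    obtain ⟨i, j, A, e⟩ := ht hy
    exact ⟨A, i, j, e⟩
  choose! fA hf using ht'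
  -- All finite intersections of the sets occurring in `x` and of the `D i`. The `D i` are included
  -- because the product of two matrix units inserts `w_j^* w_j = p (D j)`. Finiteness of `V` is
  -- what makes the algebra below finite-dimensional.
  let V : Finset (boolAlg X) :=
    (t.image fA ∪ Finset.univ.image D).powerset.image fun S => S.inf id
  have hVinf : ∀ A ∈ V, ∀ B ∈ V, A ⊓ B ∈ V := by
    intro A hA B hB
    obtain ⟨S, hS, rfl⟩ := Finset.mem_image.mp hA
    obtain ⟨S', hS', rfl⟩ := Finset.mem_image.mp hB
    refine Finset.mem_image.mpr ⟨S ∪ S', ?_, Finset.inf_union⟩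
    exact Finset.mem_powerset.mpr
      (Finset.union_subset (Finset.mem_powerset.mp hS) (Finset.mem_powerset.mp hS'))
  have hVmem : ∀ A ∈ t.image fA ∪ Finset.univ.image D, A ∈ V := fun A hA =>
    Finset.mem_image.mpr ⟨{A}, Finset.mem_powerset.mpr (Finset.singleton_subset_iff.mpr hA),
      by simp⟩
  have hVt : ∀ y ∈ t, fA y ∈ V := fun y hy =>
    hVmem _ (Finset.mem_union_left _ (Finset.mem_image_of_mem _ hy))
  have hVD : ∀ i, D i ∈ V := fun i =>
    hVmem _ (Finset.mem_union_right _ (Finset.mem_image_of_mem _ (Finset.mem_univ i)))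
  let S : Set E := {y | ∃ i j, ∃ A ∈ V, y = w i * p A * star (w j)}
  have hS : S.Finite := by
    refine (Set.finite_range fun q : ι × ι × V => w q.1 * p q.2.2 * star (w q.2.1)).subset ?_
    rintro y ⟨i, j, A, hA, rfl⟩
    exact ⟨(i, j, ⟨A, hA⟩), rfl⟩
  have hSsub : S ⊆ {y | ∃ i j A, y = w i * p A * star (w j)} := by
    rintro y ⟨i, j, A, -, rfl⟩
    exact ⟨i, j, A, rfl⟩
  -- A product of two elements of `S` is again in `S` or is zero, hence the passage through `insert
  -- 0 S`.
  have hmul : ∀ a b, a ∈ Submodule.span ℂ S → b ∈ Submodule.span ℂ S →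
      a * b ∈ Submodule.span ℂ S := by
    intro a b ha hb
    refine Submodule.span_mono ?_ (Submodule.span_mul_span ℂ S S ▸ Submodule.mul_mem_mul ha hb)
      |> fun hm => (Submodule.span_le.mpr (Set.insert_subset (zero_mem _)
        Submodule.subset_span) : Submodule.span ℂ (insert 0 S) ≤ Submodule.span ℂ S) hm
    rintro _ ⟨_, ⟨i, j, A, hA, rfl⟩, _, ⟨k, l, A', hA', rfl⟩, rfl⟩
    change w i * p A * star (w j) * (w k * p A' * star (w l)) ∈ _
    rw [show w i * p A * star (w j) * (w k * p A' * star (w l)) =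
      w i * p A * (star (w j) * w k) * p A' * star (w l) by simp only [mul_assoc]]
    by_cases hjk : j = k
    · subst hjk
      refine Or.inr ⟨i, l, A ⊓ D j ⊓ A', hVinf _ (hVinf _ hA _ (hVD j)) _ hA', ?_⟩
      rw [hw, h.map_inf, h.map_inf]
      simp only [mul_assoc]
    · left
      rw [hw' _ _ hjk, mul_zero, zero_mul, zero_mul]
  have hstar : ∀ a, a ∈ Submodule.span ℂ S → star a ∈ Submodule.span ℂ S := by
    intro a ha
    induction ha using Submodule.span_induction with
    | mem y hy =>
      obtain ⟨i, j, A, hA, rfl⟩ := hy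
      refine Submodule.subset_span ⟨j, i, A, hA, ?_⟩
      rw [star_mul, star_mul, star_star, h.star_p, mul_assoc]
    | zero => simp
    | add y z _ _ hy hz => rw [star_add]; exact add_mem hy hz
    | smul c y _ hy => rw [star_smul]; exact Submodule.smul_mem _ _ hy
  let N : NonUnitalStarSubalgebra ℂ E :=
    { (Submodule.span ℂ S).toNonUnitalSubalgebra hmul with star_mem' := fun {a} => hstar a }
  -- Finite dimension makes `N` closed, hence a C*-algebra, on which an injective `*`-homomorphism
  -- is isometric.
  have : FiniteDimensional ℂ (Submodule.span ℂ S) := FiniteDimensional.span_of_finite ℂ hS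
  have hclosed : IsClosed (N : Set E) := (Submodule.span ℂ S).closed_of_finiteDimensional
  have hxN : x ∈ N := by
    change x ∈ Submodule.span ℂ S
    refine Submodule.span_mono ?_ hxt
    intro y hy
    obtain ⟨i, j, e⟩ := hf y hy
    exact ⟨i, j, fA y, hVt y hy, e⟩
  let φ : N →⋆ₙₐ[ℂ] B := Φ.comp (NonUnitalStarSubalgebraClass.subtype N)
  have hinj : Function.Injective φ := by
    rw [injective_iff_map_eq_zero]
    rintro ⟨y, hy⟩ hy0
    exact Subtype.ext (h.eq_zero_of_mem_span_matrixUnit Φ hΦ hw hw'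
      (Submodule.span_mono hSsub hy) hy0)
  exact NonUnitalStarAlgHom.norm_map φ hinj ⟨x, hxN⟩

end IsFamily

end MatrixUnits

/-! ### Stopped words and isometry on the core. -/

section Core

variable {𝓐 : Type u} {X : Set (ℕ → 𝓐)} {E : Type v} [CStarAlgebra E]
  {p : boolAlg X → E} {s : 𝓐 → E}

/-- The words of length at most `n` in the letters of `T`. -/
abbrev WordsIn (T : Finset 𝓐) (n : ℕ) : Type u :=
  {α : List 𝓐 // α.length ≤ n ∧ ∀ a ∈ α, a ∈ T}

instance (T : Finset 𝓐) (n : ℕ) : Finite (WordsIn T n) := by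
  have h := (List.finite_length_le T n).image (List.map Subtype.val)
  refine Set.Finite.to_subtype (s := {α : List 𝓐 | α.length ≤ n ∧ ∀ a ∈ α, a ∈ T}) (h.subset ?_)
  rintro α ⟨hl, hα⟩
  exact ⟨α.attach.map fun a => ⟨a.1, hα a.1 a.2⟩, by simpa using hl, by simp⟩

/-- The set of sequences that do not begin with a letter of `T` for `k < n`, and all of `X`
otherwise. -/
noncomputable def stopSet (hX : IsSubshift X) (hne : X.Nonempty)
    (hletters : ∀ a : 𝓐, ∃ x ∈ X, ∃ n, x n = a) (T : Finset 𝓐) (n k : ℕ) : boolAlg X :=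
  if k < n then (T.sup (cylinder hX hne hletters))ᶜ else ⊤

theorem stopSet_inf_cylinder (hX : IsSubshift X) (hne : X.Nonempty)
    (hletters : ∀ a : 𝓐, ∃ x ∈ X, ∃ n, x n = a) {T : Finset 𝓐} {n k : ℕ} (hk : k < n)
    {a : 𝓐} (ha : a ∈ T) : stopSet hX hne hletters T n k ⊓ cylinder hX hne hletters a = ⊥ := by
  rw [stopSet, if_pos hk, ← disjoint_iff]
  exact disjoint_compl_left.mono_right (Finset.le_sup ha)

/-- The partial isometries `s_α` for `α` of length `n`, and for shorter words `α` in the letters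
of `T` the restriction of `s_α` to the sequences that do not begin with a letter of `T`. -/
noncomputable def stoppedWord (p : boolAlg X → E) (s : 𝓐 → E) (hX : IsSubshift X)
    (hne : X.Nonempty) (hletters : ∀ a : 𝓐, ∃ x ∈ X, ∃ n, x n = a) (T : Finset 𝓐) (n : ℕ)
    (α : List 𝓐) : E :=
  word s α * p (stopSet hX hne hletters T n α.length)

namespace IsFamily

theorem star_stoppedWord_mul_self (h : IsFamily X p s) (hX : IsSubshift X) (hne : X.Nonempty)
    (hletters : ∀ a : 𝓐, ∃ x ∈ X, ∃ n, x n = a) (T : Finset 𝓐) (n : ℕ) (α : List 𝓐) :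
    star (stoppedWord p s hX hne hletters T n α) * stoppedWord p s hX hne hletters T n α =
      p (stopSet hX hne hletters T n α.length ⊓ follower hne α) := by
  rw [stoppedWord, star_mul, h.star_p, mul_assoc, ← mul_assoc (star _),
    h.star_word_mul_word hX hne hletters, h.p_comm (follower hne α), ← mul_assoc, h.p_mul_self,
    h.map_inf]

/-- Compare `α` with the prefix `β₁` of `β` of the same length. If they differ, orthogonality of
words of equal length applies. If they agree, the next letter of `β` is in `T`, which the stop set
attached to `α` excludes. -/
theorem star_stoppedWord_mul_of_length_lt (h : IsFamily X p s) (hX : IsSubshift X)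
    (hne : X.Nonempty) (hletters : ∀ a : 𝓐, ∃ x ∈ X, ∃ n, x n = a) {T : Finset 𝓐} {n : ℕ}
    {α β : List 𝓐} (hl : α.length < β.length) (hβ : β.length ≤ n ∧ ∀ a ∈ β, a ∈ T) :
    star (stoppedWord p s hX hne hletters T n α) * stoppedWord p s hX hne hletters T n β = 0 := by
  obtain ⟨β₁, a, β₂, rfl, hl₁⟩ : ∃ β₁ a β₂, β = β₁ ++ a :: β₂ ∧ α.length = β₁.length :=
    ⟨β.take α.length, β[α.length], β.drop (α.length + 1), by simp, by simp [hl.le]⟩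
  have key : p (stopSet hX hne hletters T n α.length) * (star (word s α) * word s β₁) * s a = 0 := by
    by_cases hαβ : α = β₁
    · subst hαβ
      rw [h.star_word_mul_word hX hne hletters, h.p_comm, ← h.isPartialIsometry a,
        h.s_mul_star hX hne hletters, mul_assoc, ← mul_assoc (p (stopSet _ _ _ _ _ _)), ← h.map_inf,
        stopSet_inf_cylinder hX hne hletters (hl.trans_le hβ.1) (hβ.2 a (by simp)), h.map_bot,
        zero_mul, mul_zero]
    · rw [h.star_word_mul_word_of_length_eq hX hne hletters hl₁ hαβ, mul_zero, zero_mul]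
  simp only [stoppedWord, star_mul, h.star_p, word_append, word_cons]
  simp only [← mul_assoc] at key ⊢
  rw [key, zero_mul, zero_mul]

theorem star_stoppedWord_mul_of_ne (h : IsFamily X p s) (hX : IsSubshift X) (hne : X.Nonempty)
    (hletters : ∀ a : 𝓐, ∃ x ∈ X, ∃ n, x n = a) {T : Finset 𝓐} {n : ℕ}
    (α β : WordsIn T n) (hαβ : α ≠ β) :
    star (stoppedWord p s hX hne hletters T n α) * stoppedWord p s hX hne hletters T n β = 0 := by
  rcases lt_trichotomy α.1.length β.1.length with hl | hl | hl
  · exact h.star_stoppedWord_mul_of_length_lt hX hne hletters hl β.2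
  · rw [stoppedWord, stoppedWord, star_mul, mul_assoc, ← mul_assoc (star (word s _)),
      h.star_word_mul_word_of_length_eq hX hne hletters hl (fun e => hαβ (Subtype.ext e)),
      zero_mul, mul_zero]
  · have := congrArg star (h.star_stoppedWord_mul_of_length_lt hX hne hletters hl α.2)
    simpa using this

theorem p_sup_cylinder (h : IsFamily X p s) (hX : IsSubshift X) (hne : X.Nonempty)
    (hletters : ∀ a : 𝓐, ∃ x ∈ X, ∃ n, x n = a) (T : Finset 𝓐) :
    p (T.sup (cylinder hX hne hletters)) = ∑ a ∈ T, s a * star (s a) := by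
  classical
  induction T using Finset.induction_on with
  | empty => simp [h.map_bot]
  | insert a T ha ih =>
    have hd : cylinder hX hne hletters a ⊓ T.sup (cylinder hX hne hletters) = ⊥ := by
      rw [← disjoint_iff, Finset.disjoint_sup_right]
      intro b hb
      exact disjoint_iff.mpr (disjoint_cylinder hX hne hletters fun e => ha (e ▸ hb))
    rw [Finset.sup_insert, Finset.sum_insert ha, h.map_sup, hd, h.map_bot, sub_zero, ih,
      h.s_mul_star hX hne hletters]

/-- Below length `n`, the unit splits as the stop projection plus the sum of `s_a s_a^*` over `T`.
The first part gives a matrix unit, because words of equal length share the stop set; the others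
lengthen both words by `a`. At length `n` the stop set is everything and the process ends. -/
theorem word_mem_span_stoppedWord (h : IsFamily X p s) (hX : IsSubshift X) (hne : X.Nonempty)
    (hletters : ∀ a : 𝓐, ∃ x ∈ X, ∃ n, x n = a) {T : Finset 𝓐} {n : ℕ}
    (α β : WordsIn T n) (hl : α.1.length = β.1.length) (A : boolAlg X) :
    word s α.1 * p A * star (word s β.1) ∈ Submodule.span ℂ
      {y | ∃ (i j : WordsIn T n) (A : boolAlg X), y = stoppedWord p s hX hne hletters T n i *
        p A * star (stoppedWord p s hX hne hletters T n j)} := by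
  -- The induction runs on the number `m` of letters that may still be appended.
  obtain ⟨m, hm⟩ : ∃ m, α.1.length + m = n := ⟨_, Nat.add_sub_cancel' α.2.1⟩
  have hrestrict : ∀ (α β : List 𝓐) (A : boolAlg X), α.length = β.length →
      stoppedWord p s hX hne hletters T n α * p A * star (stoppedWord p s hX hne hletters T n β) =
        word s α * (p A * p (stopSet hX hne hletters T n α.length)) * star (word s β) := by
    intro α β A hl
    rw [stoppedWord, stoppedWord, star_mul, h.star_p, ← hl, mul_assoc (word s α),
      mul_assoc (word s α), mul_assoc (word s α), ← mul_assoc (p _ * p A), mul_assoc (p _),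
      h.p_comm _ (stopSet _ _ _ _ _ _), ← mul_assoc (p _) (p _), h.p_mul_self, mul_assoc]
  induction m generalizing α β A with
  | zero =>
    refine Submodule.subset_span ⟨α, β, A, ?_⟩
    rw [hrestrict _ _ _ hl, stopSet, if_neg (by omega), h.map_top, mul_one]
  | succ m ih =>
    have hlt : α.1.length < n := by omega
    have hsplit : p A = p A * p (stopSet hX hne hletters T n α.1.length) +
        ∑ a ∈ T, p A * (s a * star (s a)) := by
      rw [stopSet, if_pos hlt, h.p_compl, ← Finset.mul_sum, ← mul_add,
        h.p_sup_cylinder hX hne hletters, sub_add_cancel, mul_one]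
    rw [hsplit, mul_add, add_mul, ← hrestrict _ _ _ hl, Finset.mul_sum, Finset.sum_mul]
    refine add_mem (Submodule.subset_span ⟨α, β, A, rfl⟩) (Submodule.sum_mem _ fun a ha => ?_)
    obtain ⟨A', hA'⟩ := h.exists_p_mul_s hX hne hletters A a
    have hα : (α.1 ++ [a]).length ≤ n ∧ ∀ b ∈ α.1 ++ [a], b ∈ T :=
      ⟨by simp; omega, by simpa using fun b hb => hb.elim (α.2.2 b) (· ▸ ha)⟩
    have hβ : (β.1 ++ [a]).length ≤ n ∧ ∀ b ∈ β.1 ++ [a], b ∈ T :=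
      ⟨by simp; omega, by simpa using fun b hb => hb.elim (β.2.2 b) (· ▸ ha)⟩
    have e : word s α.1 * (p A * (s a * star (s a))) * star (word s β.1) =
        word s (α.1 ++ [a]) * p A' * star (word s (β.1 ++ [a])) := by
      rw [← mul_assoc (p A), hA', word_append, word_append, word_singleton, star_mul]
      simp only [mul_assoc]
    rw [e]
    exact ih ⟨_, hα⟩ ⟨_, hβ⟩ (by simpa using hl) A' (by simp; omega)

end IsFamily

/-- The linear span of the `s_α p_A s_β^*` with `α` and `β` of the same length. -/
noncomputable def core (p : boolAlg X → E) (s : 𝓐 → E) : Submodule ℂ E :=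
  Submodule.span ℂ {y | ∃ (α β : List 𝓐) (A : boolAlg X), α.length = β.length ∧
    y = word s α * p A * star (word s β)}

/-- A `*`-homomorphism that kills no `p A` with `A ≠ ⊥` is isometric on the core. -/
theorem IsFamily.norm_map_of_mem_core (h : IsFamily X p s) (hX : IsSubshift X)
    (hne : X.Nonempty) (hletters : ∀ a : 𝓐, ∃ x ∈ X, ∃ n, x n = a)
    {B : Type w} [NonUnitalCStarAlgebra B] (Φ : E →⋆ₙₐ[ℂ] B)
    (hΦ : ∀ A, A ≠ ⊥ → Φ (p A) ≠ 0) {x : E} (hx : x ∈ core p s) : ‖Φ x‖ = ‖x‖ := by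
  classical
  -- Membership is claimed for all larger `T` and `n`, so that two summands can be expressed in a
  -- common system of matrix units.
  obtain ⟨T, n, hT⟩ : ∃ (T₀ : Finset 𝓐) (n₀ : ℕ), ∀ T, T₀ ⊆ T → ∀ n, n₀ ≤ n →
      x ∈ Submodule.span ℂ {y | ∃ (i j : WordsIn T n) (A : boolAlg X),
        y = stoppedWord p s hX hne hletters T n i * p A *
          star (stoppedWord p s hX hne hletters T n j)} := by
    induction hx using Submodule.span_induction with
    | mem y hy =>
      obtain ⟨α, β, A, hl, rfl⟩ := hy
      refine ⟨α.toFinset ∪ β.toFinset, α.length, fun T hT n hn => ?_⟩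
      exact h.word_mem_span_stoppedWord hX hne hletters
        ⟨α, hn, fun a ha => hT (by simp [ha])⟩ ⟨β, hl ▸ hn, fun a ha => hT (by simp [ha])⟩ hl A
    | zero => exact ⟨∅, 0, fun _ _ _ _ => zero_mem _⟩
    | add y z _ _ hy hz =>
      obtain ⟨T₁, n₁, h₁⟩ := hy
      obtain ⟨T₂, n₂, h₂⟩ := hz
      exact ⟨T₁ ∪ T₂, max n₁ n₂, fun T hT n hn => add_mem
        (h₁ T (Finset.union_subset_left hT) n (le_of_max_le_left hn))
        (h₂ T (Finset.union_subset_right hT) n (le_of_max_le_right hn))⟩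
    | smul c y _ hy =>
      obtain ⟨T₁, n₁, h₁⟩ := hy
      exact ⟨T₁, n₁, fun T hT n hn => Submodule.smul_mem _ c (h₁ T hT n hn)⟩
  exact h.norm_map_of_mem_span_matrixUnit Φ hΦ
    (w := fun α : WordsIn T n => stoppedWord p s hX hne hletters T n α)
    (fun α => h.star_stoppedWord_mul_self hX hne hletters T n α)
    (h.star_stoppedWord_mul_of_ne hX hne hletters) (hT T subset_rfl n le_rfl)

end Core

/-! ### Density of the span of the `s_α p_A s_β^*`. -/

section Words

variable {𝓐 : Type u} {X : Set (ℕ → 𝓐)} {E : Type v} [CStarAlgebra E]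
  {p : boolAlg X → E} {s : 𝓐 → E}

/-- The linear span of the `s_α p_A s_β^*`. -/
noncomputable def wordSpan (p : boolAlg X → E) (s : 𝓐 → E) : Submodule ℂ E :=
  Submodule.span ℂ {y | ∃ (α β : List 𝓐) (A : boolAlg X), y = word s α * p A * star (word s β)}

namespace IsFamily

theorem star_mem_wordSpan (h : IsFamily X p s) {x : E} (hx : x ∈ wordSpan p s) :
    star x ∈ wordSpan p s := by
  induction hx using Submodule.span_induction with
  | mem y hy =>
    obtain ⟨α, β, A, rfl⟩ := hy
    refine Submodule.subset_span ⟨β, α, A, ?_⟩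
    rw [star_mul, star_mul, star_star, h.star_p, mul_assoc]
  | zero => simp
  | add y z _ _ hy hz => rw [star_add]; exact add_mem hy hz
  | smul c y _ hy => rw [star_smul]; exact Submodule.smul_mem _ _ hy

/-- Either `β` is a prefix of `μ`, and the projection `s_β^* s_β` moves past the rest of `μ`, or the
product vanishes by orthogonality. The case of longer `β` follows by taking adjoints. -/
theorem word_mul_word_mem_wordSpan (h : IsFamily X p s) (hX : IsSubshift X) (hne : X.Nonempty)
    (hletters : ∀ a : 𝓐, ∃ x ∈ X, ∃ n, x n = a) (α β μ ν : List 𝓐) (A A' : boolAlg X)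
    (hl : β.length ≤ μ.length) :
    word s α * p A * star (word s β) * (word s μ * p A' * star (word s ν)) ∈ wordSpan p s := by
  have e : word s μ = word s (μ.take β.length) * word s (μ.drop β.length) := by
    rw [← word_append, List.take_append_drop]
  have e' : word s α * p A * star (word s β) * (word s μ * p A' * star (word s ν)) =
      word s α * (p A * ((star (word s β) * word s (μ.take β.length)) *
        word s (μ.drop β.length))) * p A' * star (word s ν) := by
    rw [e]; simp only [mul_assoc]
  rw [e']
  by_cases hβ : β = μ.take β.length
  · obtain ⟨A₁, hA₁⟩ := h.exists_p_mul_word hX hne hletters (A ⊓ follower hne β)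
      (μ.drop β.length)
    rw [← hβ, h.star_word_mul_word hX hne hletters, ← mul_assoc (p A), ← h.map_inf, hA₁]
    refine Submodule.subset_span ⟨α ++ μ.drop β.length, ν, A₁ ⊓ A', ?_⟩
    rw [word_append, h.map_inf]
    simp only [mul_assoc]
  · rw [h.star_word_mul_word_of_length_eq hX hne hletters (by simp [hl]) hβ]
    simp

theorem mul_mem_wordSpan (h : IsFamily X p s) (hX : IsSubshift X) (hne : X.Nonempty)
    (hletters : ∀ a : 𝓐, ∃ x ∈ X, ∃ n, x n = a) {x y : E} (hx : x ∈ wordSpan p s)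
    (hy : y ∈ wordSpan p s) : x * y ∈ wordSpan p s := by
  have hxy := Submodule.mul_mem_mul hx hy
  rw [wordSpan, Submodule.span_mul_span] at hxy
  refine Submodule.span_le.mpr ?_ hxy
  rintro _ ⟨_, ⟨α, β, A, rfl⟩, _, ⟨μ, ν, A', rfl⟩, rfl⟩
  rcases le_total β.length μ.length with hl | hl
  · exact h.word_mul_word_mem_wordSpan hX hne hletters α β μ ν A A' hl
  · have := h.star_mem_wordSpan
      (h.word_mul_word_mem_wordSpan hX hne hletters ν μ β α A' A hl)
    simpa only [star_mul, star_star, h.star_p, mul_assoc, SetLike.mem_coe] using this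

theorem p_mem_wordSpan (A : boolAlg X) : p A ∈ wordSpan p s :=
  Submodule.subset_span ⟨[], [], A, by simp [word_nil]⟩

theorem s_mem_wordSpan (h : IsFamily X p s) (a : 𝓐) : s a ∈ wordSpan p s :=
  Submodule.subset_span ⟨[a], [], ⊤, by simp [word_nil, word_singleton, h.map_top]⟩

end IsFamily

/-- The span of the `s_α p_A s_β^*` is dense in the unital subshift algebra. -/
theorem dense_wordSpan (hX : IsSubshift X) (hne : X.Nonempty)
    (hletters : ∀ a : 𝓐, ∃ x ∈ X, ∃ n, x n = a) :
    Dense (wordSpan (Subshift.p X) (Subshift.s X) : Set (Alg X)) := by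
  refine (UnivCStar.mk_dense (Rel X)).mono ?_
  rintro _ ⟨x, rfl⟩
  have h := isFamily X
  have hgen : ∀ g, UnivCStar.mk (Rel X) (FreeStar.of g) ∈
      wordSpan (Subshift.p X) (Subshift.s X) := fun g =>
    g.rec IsFamily.p_mem_wordSpan h.s_mem_wordSpan
  induction x using FreeStar.induct with
  | scalar c =>
    rw [AlgHomClass.commutes, Algebra.algebraMap_eq_smul_one, ← h.map_top]
    exact Submodule.smul_mem _ c (IsFamily.p_mem_wordSpan ⊤)
  | letter x =>
    rcases x with g | g
    · exact hgen g
    · rw [FreeStar.letter_inr, ← UnivCStar.star_mk]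
      exact h.star_mem_wordSpan (hgen g)
  | mul a b ha hb => rw [map_mul]; exact h.mul_mem_wordSpan hX hne hletters ha hb
  | add a b ha hb => rw [map_add]; exact add_mem ha hb

end Words

/-! ### The gauge action and averaging over it. -/

section Gauge

variable {𝓐 : Type u} {X : Set (ℕ → 𝓐)}

theorem norm_gauge (z : Circle) (x : Alg X) : ‖gauge X z x‖ = ‖x‖ :=
  NonUnitalStarAlgHom.norm_map (gauge X z) (gauge X z).injective x

theorem gauge_word (z : Circle) (α : List 𝓐) :
    gauge X z (word (s X) α) = (z : ℂ) ^ α.length • word (s X) α := by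
  rw [← word_smul]
  induction α with
  | nil => rw [word_nil, word_nil]; exact map_one (gaugeHom X z)
  | cons a α ih => rw [word_cons, word_cons, map_mul, ih, gauge_s]

theorem gauge_word_mul_star_word (z : Circle) (α β : List 𝓐) (A : boolAlg X) :
    gauge X z (word (s X) α * p X A * star (word (s X) β)) =
      ((z : ℂ) ^ α.length * star (z : ℂ) ^ β.length) •
        (word (s X) α * p X A * star (word (s X) β)) := by
  rw [map_mul, map_mul, map_star, gauge_word, gauge_word, gauge_p, star_smul, star_pow,
    smul_mul_assoc, smul_mul_smul_comm]

theorem map_smul_gauge (z : Circle) (c : ℂ) (x : Alg X) :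
    gauge X z (c • x) = c • gauge X z x := map_smul (gaugeHom X z) c x

/-- The gauge action is strongly continuous. -/
theorem continuous_gauge (hX : IsSubshift X) (hne : X.Nonempty)
    (hletters : ∀ a : 𝓐, ∃ x ∈ X, ∃ n, x n = a) (x : Alg X) :
    Continuous fun z : Circle => gauge X z x := by
  have hspan : ∀ y ∈ wordSpan (p X) (s X), Continuous fun z : Circle => gauge X z y := by
    intro y hy
    induction hy using Submodule.span_induction with
    | mem y hy =>
      obtain ⟨α, β, A, rfl⟩ := hy
      simp only [gauge_word_mul_star_word]
      fun_prop
    | zero => simpa using continuous_const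
    | add y z _ _ hy hz => simp only [map_add]; exact hy.add hz
    | smul c y _ hy => simp only [map_smul_gauge]; exact hy.const_smul c
  -- Each `γ_z` is isometric, so approximating `x` from the dense span approximates the whole orbit
  -- map uniformly in `z`.
  refine continuous_of_uniform_approx_of_continuous fun U hU => ?_
  obtain ⟨ε, hε, hεU⟩ := Metric.mem_uniformity_dist.mp hU
  obtain ⟨y, hy, hxy⟩ := (dense_wordSpan hX hne hletters).exists_dist_lt x hε
  refine ⟨_, hspan y hy, fun z => hεU ?_⟩
  rwa [dist_eq_norm, ← map_sub, norm_gauge, ← dist_eq_norm]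

theorem continuous_gauge_exp (hX : IsSubshift X) (hne : X.Nonempty)
    (hletters : ∀ a : 𝓐, ∃ x ∈ X, ∃ n, x n = a) (x : Alg X) :
    Continuous fun θ : ℝ => gauge X (Circle.exp θ) x :=
  (continuous_gauge hX hne hletters x).comp Circle.exp.continuous

/-- The integrand is `exp (i(m - n)θ)`, a nontrivial character. This is why averaging removes the
terms with `|α| ≠ |β|`. -/
theorem integral_circle_pow_mul_star_pow {m n : ℕ} (hmn : m ≠ n) :
    ∫ θ in (0 : ℝ)..2 * Real.pi, (Circle.exp θ : ℂ) ^ m * star (Circle.exp θ : ℂ) ^ n = 0 := by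
  have hc : ((m : ℂ) - n) * Complex.I ≠ 0 :=
    mul_ne_zero (sub_ne_zero.mpr (Nat.cast_injective.ne hmn)) Complex.I_ne_zero
  have e : ∀ θ : ℝ, (Circle.exp θ : ℂ) ^ m * star (Circle.exp θ : ℂ) ^ n =
      Complex.exp ((((m : ℂ) - n) * Complex.I) * θ) := by
    intro θ
    rw [Circle.coe_exp, Complex.star_def, ← Complex.exp_conj, ← Complex.exp_nat_mul,
      ← Complex.exp_nat_mul, ← Complex.exp_add, map_mul, Complex.conj_ofReal, Complex.conj_I]
    congr 1
    ring
  simp only [e]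
  rw [integral_exp_mul_complex hc]
  have h1 : Complex.exp (((m : ℂ) - n) * Complex.I * ((2 * Real.pi : ℝ) : ℂ)) = 1 := by
    rw [← Complex.exp_int_mul_two_pi_mul_I ((m : ℤ) - n)]
    congr 1
    push_cast
    ring
  rw [h1]
  simp

/-- Averaging over the gauge action maps the unital subshift algebra to the closure of the core. -/
theorem integral_gauge_mem_closure_core (hX : IsSubshift X) (hne : X.Nonempty)
    (hletters : ∀ a : 𝓐, ∃ x ∈ X, ∃ n, x n = a) (x : Alg X) :
    ∫ θ in (0 : ℝ)..2 * Real.pi, gauge X (Circle.exp θ) x ∈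
      (core (p X) (s X)).topologicalClosure := by
  have hint : ∀ x : Alg X, IntervalIntegrable (fun θ : ℝ => gauge X (Circle.exp θ) x)
      MeasureTheory.volume 0 (2 * Real.pi) := fun x =>
    (continuous_gauge_exp hX hne hletters x).intervalIntegrable _ _
  -- The average, left without the factor `1 / 2π`, is Lipschitz with constant `2π`; this reduces
  -- the claim to the dense span.
  have hcont : Continuous fun x : Alg X =>
      ∫ θ in (0 : ℝ)..2 * Real.pi, gauge X (Circle.exp θ) x := by
    refine (LipschitzWith.of_dist_le_mul (K := ⟨|2 * Real.pi - 0|, abs_nonneg _⟩)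
      fun x y => ?_).continuous
    rw [dist_eq_norm, ← intervalIntegral.integral_sub (hint x) (hint y), dist_eq_norm]
    refine (intervalIntegral.norm_integral_le_of_norm_le_const (C := ‖x - y‖)
      fun θ _ => ?_).trans (mul_comm _ _).le
    rw [← map_sub, norm_gauge]
  refine (dense_wordSpan hX hne hletters).induction (P := fun x =>
    ∫ θ in (0 : ℝ)..2 * Real.pi, gauge X (Circle.exp θ) x ∈
      (core (p X) (s X)).topologicalClosure) (fun y hy => ?_)
    ((Submodule.isClosed_topologicalClosure _).preimage hcont) x
  induction hy using Submodule.span_induction with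
  | mem y hy =>
    obtain ⟨α, β, A, rfl⟩ := hy
    simp only [gauge_word_mul_star_word]
    rw [intervalIntegral.integral_smul_const]
    by_cases hl : α.length = β.length
    · exact Submodule.smul_mem _ _ (Submodule.le_topologicalClosure _
        (Submodule.subset_span ⟨α, β, A, hl, rfl⟩))
    · rw [integral_circle_pow_mul_star_pow hl, zero_smul]
      exact zero_mem _
  | zero => simp
  | add y z _ _ hy hz =>
    simp only [map_add]
    rw [intervalIntegral.integral_add (hint y) (hint z)]
    exact add_mem hy hz
  | smul c y _ hy =>
    simp only [map_smul_gauge]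
    rw [intervalIntegral.integral_smul]
    exact Submodule.smul_mem _ c hy

end Gauge

/-! ### Faithfulness of the average, and the conclusion. -/

/-- If the integral of a continuous positive function in a C*-algebra vanishes, then so does the
function at the interior points. -/
theorem eq_zero_of_integral_star_mul_self_eq_zero {E : Type v} [CStarAlgebra E] {f : ℝ → E}
    (hf : Continuous f) {a b t : ℝ} (ht : t ∈ Set.Ioo a b)
    (h0 : ∫ θ in a..b, star (f θ) * f θ = 0) : f t = 0 := by
  let _ := CStarAlgebra.spectralOrder E
  have _ := CStarAlgebra.spectralOrderedRing E
  have hg : Continuous fun θ => star (f θ) * f θ := hf.star.mul hf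
  -- The integrals over `[a, r]` and `[r, b]` are both positive and add up to zero. So the primitive
  -- vanishes on the open interval, and so does its derivative, the integrand.
  have hzero : ∀ r ∈ Set.Ioo a b, ∫ θ in a..r, star (f θ) * f θ = 0 := by
    intro r hr
    have h1 : 0 ≤ ∫ θ in a..r, star (f θ) * f θ := by
      rw [intervalIntegral.integral_of_le hr.1.le]
      exact MeasureTheory.integral_nonneg fun θ => star_mul_self_nonneg (f θ)
    have h2 : 0 ≤ ∫ θ in r..b, star (f θ) * f θ := by
      rw [intervalIntegral.integral_of_le hr.2.le]
      exact MeasureTheory.integral_nonneg fun θ => star_mul_self_nonneg (f θ)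
    have h3 := intervalIntegral.integral_add_adjacent_intervals
      (hg.intervalIntegrable (μ := MeasureTheory.volume) a r) (hg.intervalIntegrable r b)
    rw [h0] at h3
    exact le_antisymm (by rw [eq_neg_of_add_eq_zero_left h3]; exact neg_nonpos.mpr h2) h1
  have hd := (intervalIntegral.integral_hasDerivAt_right (hg.intervalIntegrable a t)
    (hg.stronglyMeasurableAtFilter _ _) hg.continuousAt :
    HasDerivAt (fun r => ∫ θ in a..r, star (f θ) * f θ) _ t)
  have hev : (fun r => ∫ θ in a..r, star (f θ) * f θ) =ᶠ[nhds t] fun _ => 0 :=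
    Filter.eventually_of_mem (Ioo_mem_nhds ht.1 ht.2) hzero
  have hd' := (hasDerivAt_const t (0 : E)).congr_of_eventuallyEq hev
  exact CStarRing.star_mul_self_eq_zero_iff (f t) |>.mp (hd.unique hd')

end Subshift

theorem mainTheorem9 {𝓐 : Type*} (X : Set (ℕ → 𝓐)) (hX : Subshift.IsSubshift X)
    (hletters : X.Nonempty → ∀ a : 𝓐, ∃ x ∈ X, ∃ n, x n = a)
    {B : Type*} [NonUnitalCStarAlgebra B] (Φ : Subshift.Alg X →⋆ₙₐ[ℂ] B)
    (hΦ : ∀ A : Subshift.boolAlg X, A ≠ ⊥ → Φ (Subshift.p X A) ≠ 0)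
    (β : Circle →* (B ≃⋆ₐ[ℂ] B)) (hβ : ∀ b : B, Continuous fun z : Circle => β z b)
    (hΦβ : ∀ (z : Circle) (x : Subshift.Alg X), Φ (Subshift.gauge X z x) = β z (Φ x)) :
    Function.Injective Φ := by
  have h := Subshift.isFamily X
  rcases X.eq_empty_or_nonempty with hemp | hne
  -- For empty `X` the relations `p_X = 1` and `p_∅ = 0` force the algebra to be zero.
  · have htop : (⊤ : Subshift.boolAlg X) = ⊥ := by
      have : IsEmpty X := Set.isEmpty_coe_sort.mpr hemp
      exact Subtype.ext (Set.eq_empty_of_isEmpty _)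
    have h10 : (1 : Subshift.Alg X) = 0 := by rw [← h.map_top, htop, h.map_bot]
    have := subsingleton_of_zero_eq_one h10.symm
    exact Function.injective_of_subsingleton Φ
  have hletters := hletters hne
  have hΦc : Continuous Φ := AddMonoidHomClass.continuous_of_bound Φ 1 fun x => by
    rw [one_mul]; exact NonUnitalStarAlgHom.norm_apply_le Φ x
  rw [injective_iff_map_eq_zero]
  intro x hx
  have hgx := Subshift.continuous_gauge_exp hX hne hletters x
  have hstar : ∀ θ : ℝ, Subshift.gauge X (Circle.exp θ) (star x * x) =
      star (Subshift.gauge X (Circle.exp θ) x) * Subshift.gauge X (Circle.exp θ) x := fun θ => by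
    rw [map_mul, map_star]
  have hmem := Subshift.integral_gauge_mem_closure_core hX hne hletters (star x * x)
  simp only [hstar] at hmem
  have hnorm : ∀ y ∈ (Subshift.core (Subshift.p X) (Subshift.s X)).topologicalClosure,
      ‖Φ y‖ = ‖y‖ := by
    intro y hy
    exact closure_minimal
      (fun y hy => h.norm_map_of_mem_core hX hne hletters Φ hΦ hy)
      (isClosed_eq hΦc.norm continuous_norm) hy
  -- `Φ` passes under the integral, and the intertwining relation gives `Φ (γ_z x) = β_z (Φ x) = 0`.
  have hzero : Φ (∫ θ in (0 : ℝ)..2 * Real.pi, star (Subshift.gauge X (Circle.exp θ) x) *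
      Subshift.gauge X (Circle.exp θ) x) = 0 := by
    let L : Subshift.Alg X →L[ℂ] B :=
      { toFun := Φ, map_add' := map_add Φ, map_smul' := map_smul Φ, cont := hΦc }
    refine (L.intervalIntegral_comp_comm
      ((hgx.star.mul hgx).intervalIntegrable _ _)).symm.trans ?_
    have : ∀ θ : ℝ, L (star (Subshift.gauge X (Circle.exp θ) x) *
        Subshift.gauge X (Circle.exp θ) x) = 0 := fun θ => by
      change Φ _ = 0
      rw [map_mul, hΦβ, hx, map_zero, mul_zero]
    exact (intervalIntegral.integral_congr fun θ _ => this θ).trans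
      intervalIntegral.integral_zero
  have hint := hnorm _ hmem
  rw [hzero, norm_zero] at hint
  -- Any interior point would serve as `t`: one `γ_z x = 0` suffices, since `γ_z` is isometric.
  have := Subshift.eq_zero_of_integral_star_mul_self_eq_zero hgx
    (t := Real.pi) ⟨Real.pi_pos, by linarith [Real.pi_pos]⟩ (norm_eq_zero.mp hint.symm)
  rwa [← norm_eq_zero, Subshift.norm_gauge, norm_eq_zero] at this
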